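/- For a group $K$ and $g\in K$ write $C_K(g)$ for the centralizer of $g$. Let $K$ be a non-cyclic torsion-free hyperbolic group (so that $C_K(g)$ is cyclic for every $g\neq 1$). The \emph{basic sorts} of $K$ are the home sort $K$ itself and the sets of classes of the following equivalence relations, for all $m,n\in\mathbb N=\{0,1,2,\dots\}$: * conjugation on $K$; * the $m$-left-coset relation on $K^2$: $(a_1,b_1)\sim(a_2,b_2)$ iff either $b_1=b_2=1$, or $b_1,b_2\ne 1$, $C_K(b_1)=C_K(b_2)=\langle b\rangle$ and $a_1^{-1}a_2\in\langle b^m\rangle$; * the $m$-right-coset relation on $K^2$: the same with $a_1a_2^{-1}\in\langle b^m\rangle$; * the $m,n$-double-coset relation on $K^3$: $(a_1,b_1,c_1)\sim(a_2,b_2,c_2)$ iff either ($a_1=1$ or $c_1=1$) and ($a_2=1$ or $c_2=1$), or $a_1,c_1,a_2,c_2\neq 1$, $C_K(a_1)=C_K(a_2)=\langle a\rangle$, $C_K(c_1)=C_K(c_2)=\langle c\rangle$ and $\gamma b_1\varepsilon=b_2$ for some $\gamma\in\langle a^m\rangle$, $\varepsilon\in\langle c^n\rangle$. Let $K^{we}$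 be the disjoint union of all basic sorts of $K$; $\mathrm{Aut}(K)$ acts on it. An element of $K^{we}$ is called trivial if it is the class of a tuple all of whose entries are $1$. Let $G$ be a torsion-free hyperbolic group and $H=G*\langle e\rangle$ with $e$ of infinite order. Let $G^{we}\subseteq H^{we}$ be the set of the elements that are represented by tuples from $G$. For $a\in G$ let $f_a$ be the automorphism of $H$ that is the identity on $G$ and sends $e$ to $ea$. (1) Let $a,c\in G\setminus\{1\}$ with $C_G(a)\neq C_G(c)$. Then every $\beta\in H^{we}\setminus G^{we}$ has infinite orbit under the subgroup of $\mathrm{Aut}(H)$ generated by $f_a$ and $f_c$. (2) In particular, let $G=A*B$ be a free product of non-trivial subgroups $A,B$. Then $\mathrm{Aut}(H).\beta$ is infinite for every $\beta\in H^{we}\setminus G^{we}$. Moreover, $\mathrm{Aut}(H).\beta$ is infinite for every non-trivial $\beta\in H^{we}$ that is not the conjugacy class in $H$ of an element of $A\cup B$. -/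

import Mathlib

/-- A group is (word-)hyperbolic if it has a finite generating set whose Cayley graph, with the
word metric on its vertices, satisfies Gromov's four-point condition for some constant. -/
def IsHyperbolicGroup (G : Type*) [Group G] : Prop :=
  ∃ S : Finset G, Subgroup.closure (S : Set G) = ⊤ ∧
    ∃ δ : ℕ, ∀ x y z w : G,
      (SimpleGraph.mulCayley (S : Set G)).dist x y + (SimpleGraph.mulCayley (S : Set G)).dist z w ≤
        max
          ((SimpleGraph.mulCayley (S : Set G)).dist x z +
            (SimpleGraph.mulCayley (S : Set G)).dist y w)
          ((SimpleGraph.mulCayley (S : Set G)).dist x w +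
            (SimpleGraph.mulCayley (S : Set G)).dist y z) + δ

/-- No element other than `1` has finite order. -/
def IsTorsionFreeGroup (G : Type*) [Group G] : Prop :=
  ∀ g : G, g ≠ 1 → ¬ IsOfFinOrder g

/-- The centralizer of an element. -/
abbrev elemCentralizer {G : Type*} [Group G] (g : G) : Subgroup G :=
  Subgroup.centralizer {g}

/-- The `m`-left-coset relation on pairs `(a, b)`. The pairs with `b = 1` form one class. -/
def LeftCosetRel (G : Type*) [Group G] (m : ℕ) (x y : G × G) : Prop :=
  (x.2 = 1 ∧ y.2 = 1) ∨
  (x.2 ≠ 1 ∧ y.2 ≠ 1 ∧ ∃ b : G,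
    elemCentralizer x.2 = Subgroup.zpowers b ∧ elemCentralizer y.2 = Subgroup.zpowers b ∧
    x.1⁻¹ * y.1 ∈ Subgroup.zpowers (b ^ m))

/-- The `m`-right-coset relation on pairs `(a, b)`. The pairs with `b = 1` form one class. -/
def RightCosetRel (G : Type*) [Group G] (m : ℕ) (x y : G × G) : Prop :=
  (x.2 = 1 ∧ y.2 = 1) ∨
  (x.2 ≠ 1 ∧ y.2 ≠ 1 ∧ ∃ b : G,
    elemCentralizer x.2 = Subgroup.zpowers b ∧ elemCentralizer y.2 = Subgroup.zpowers b ∧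
    x.1 * y.1⁻¹ ∈ Subgroup.zpowers (b ^ m))

/-- The `m,n`-double-coset relation on triples `(a, b, c)`. The triples with `a = 1` or `c = 1`
form one class. -/
def DoubleCosetRel (G : Type*) [Group G] (m n : ℕ) (x y : G × G × G) : Prop :=
  ((x.1 = 1 ∨ x.2.2 = 1) ∧ (y.1 = 1 ∨ y.2.2 = 1)) ∨
  (x.1 ≠ 1 ∧ x.2.2 ≠ 1 ∧ y.1 ≠ 1 ∧ y.2.2 ≠ 1 ∧ ∃ a c : G,
    elemCentralizer x.1 = Subgroup.zpowers a ∧ elemCentralizer y.1 = Subgroup.zpowers a ∧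
    elemCentralizer x.2.2 = Subgroup.zpowers c ∧ elemCentralizer y.2.2 = Subgroup.zpowers c ∧
    ∃ γ ∈ Subgroup.zpowers (a ^ m), ∃ ε ∈ Subgroup.zpowers (c ^ n), γ * x.2.1 * ε = y.2.1)

theorem zpowers_pow_eq {G : Type*} [Group G] {b b' : G} (m : ℕ)
    (h : Subgroup.zpowers b = Subgroup.zpowers b') :
    Subgroup.zpowers (b ^ m) = Subgroup.zpowers (b' ^ m) := by
  have key : ∀ u v : G, Subgroup.zpowers u = Subgroup.zpowers v →
      Subgroup.zpowers (u ^ m) ≤ Subgroup.zpowers (v ^ m) := by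
    intro u v huv
    have hu : u ∈ Subgroup.zpowers v := huv ▸ Subgroup.mem_zpowers u
    obtain ⟨k, rfl⟩ := Subgroup.mem_zpowers_iff.1 hu
    rw [Subgroup.zpowers_le]
    refine Subgroup.mem_zpowers_iff.2 ⟨k, ?_⟩
    rw [← zpow_natCast, ← zpow_natCast, ← zpow_mul, ← zpow_mul, mul_comm]
  exact le_antisymm (key _ _ h) (key _ _ h.symm)

/-- All centralizers of nontrivial elements are cyclic; this holds in torsion-free hyperbolic
groups and is what makes the coset relations reflexive. -/
def HasCyclicCentralizers (G : Type*) [Group G] : Prop :=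
  ∀ g : G, g ≠ 1 → ∃ b : G, elemCentralizer g = Subgroup.zpowers b

theorem leftCosetRel_equivalence {G : Type*} [Group G] (hG : HasCyclicCentralizers G) (m : ℕ) :
    Equivalence (LeftCosetRel G m) where
  refl x := by
    by_cases h : x.2 = 1
    · exact Or.inl ⟨h, h⟩
    · obtain ⟨b, hb⟩ := hG x.2 h
      exact Or.inr ⟨h, h, b, hb, hb, by simp⟩
  symm := by
    rintro x y (⟨h1, h2⟩ | ⟨h1, h2, b, h3, h4, h5⟩)
    · exact Or.inl ⟨h2, h1⟩
    · refine Or.inr ⟨h2, h1, b, h4, h3, ?_⟩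
      simpa using inv_mem h5
  trans := by
    rintro x y z (⟨h1, h2⟩ | ⟨h1, h2, b, h3, h4, h5⟩) (⟨k1, k2⟩ | ⟨k1, k2, b', k3, k4, k5⟩)
    · exact Or.inl ⟨h1, k2⟩
    · exact absurd h2 k1
    · exact absurd k1 h2
    · refine Or.inr ⟨h1, k2, b', h3.trans (h4.symm.trans k3), k4, ?_⟩
      rw [zpowers_pow_eq m (h4.symm.trans k3)] at h5
      simpa [mul_assoc] using mul_mem h5 k5

theorem rightCosetRel_equivalence {G : Type*} [Group G] (hG : HasCyclicCentralizers G) (m : ℕ) :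
    Equivalence (RightCosetRel G m) where
  refl x := by
    by_cases h : x.2 = 1
    · exact Or.inl ⟨h, h⟩
    · obtain ⟨b, hb⟩ := hG x.2 h
      exact Or.inr ⟨h, h, b, hb, hb, by simp⟩
  symm := by
    rintro x y (⟨h1, h2⟩ | ⟨h1, h2, b, h3, h4, h5⟩)
    · exact Or.inl ⟨h2, h1⟩
    · refine Or.inr ⟨h2, h1, b, h4, h3, ?_⟩
      simpa using inv_mem h5
  trans := by
    rintro x y z (⟨h1, h2⟩ | ⟨h1, h2, b, h3, h4, h5⟩) (⟨k1, k2⟩ | ⟨k1, k2, b', k3, k4, k5⟩)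
    · exact Or.inl ⟨h1, k2⟩
    · exact absurd h2 k1
    · exact absurd k1 h2
    · refine Or.inr ⟨h1, k2, b', h3.trans (h4.symm.trans k3), k4, ?_⟩
      rw [zpowers_pow_eq m (h4.symm.trans k3)] at h5
      simpa [mul_assoc] using mul_mem h5 k5

theorem doubleCosetRel_equivalence {G : Type*} [Group G] (hG : HasCyclicCentralizers G)
    (m n : ℕ) : Equivalence (DoubleCosetRel G m n) where
  refl x := by
    by_cases h : x.1 = 1 ∨ x.2.2 = 1
    · exact Or.inl ⟨h, h⟩
    · rw [not_or] at h
      obtain ⟨a, ha⟩ := hG x.1 h.1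
      obtain ⟨c, hc⟩ := hG x.2.2 h.2
      exact Or.inr ⟨h.1, h.2, h.1, h.2, a, c, ha, ha, hc, hc, 1, one_mem _, 1, one_mem _, by simp⟩
  symm := by
    rintro x y (⟨h1, h2⟩ | ⟨h1, h2, h3, h4, a, c, h5, h6, h7, h8, γ, hγ, ε, hε, h9⟩)
    · exact Or.inl ⟨h2, h1⟩
    · refine Or.inr ⟨h3, h4, h1, h2, a, c, h6, h5, h8, h7, γ⁻¹, inv_mem hγ, ε⁻¹, inv_mem hε, ?_⟩
      rw [← h9]
      group
  trans := by
    rintro x y z (⟨h1, h2⟩ | ⟨h1, h2, h3, h4, a, c, h5, h6, h7, h8, γ, hγ, ε, hε, h9⟩)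
      (⟨k1, k2⟩ | ⟨k1, k2, k3, k4, a', c', k5, k6, k7, k8, γ', kγ, ε', kε, k9⟩)
    · exact Or.inl ⟨h1, k2⟩
    · exact absurd h2 (not_or.2 ⟨k1, k2⟩)
    · exact absurd k1 (not_or.2 ⟨h3, h4⟩)
    · rw [zpowers_pow_eq m (h6.symm.trans k5)] at hγ
      rw [zpowers_pow_eq n (h8.symm.trans k7)] at hε
      refine Or.inr ⟨h1, h2, k3, k4, a', c', h5.trans (h6.symm.trans k5), k6,
        h7.trans (h8.symm.trans k7), k8, γ' * γ, mul_mem kγ hγ, ε * ε', mul_mem hε kε, ?_⟩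
      rw [← k9, ← h9]
      group

theorem elemCentralizer_map {G : Type*} [Group G] (f : MulAut G) {g b : G}
    (h : elemCentralizer g = Subgroup.zpowers b) :
    elemCentralizer (f g) = Subgroup.zpowers (f b) := by
  ext z
  have h1 : f.symm z ∈ elemCentralizer g ↔ f.symm z ∈ Subgroup.zpowers b := by rw [h]
  rw [Subgroup.mem_centralizer_singleton_iff, Subgroup.mem_zpowers_iff] at h1
  rw [Subgroup.mem_centralizer_singleton_iff, Subgroup.mem_zpowers_iff]
  rw [← f.injective.eq_iff] at h1
  simp only [map_mul, MulEquiv.apply_symm_apply] at h1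
  rw [h1]
  simp only [MulEquiv.eq_symm_apply, map_zpow]

theorem map_mem_zpowers_pow {G : Type*} [Group G] (f : MulAut G) {z b : G} {m : ℕ}
    (h : z ∈ Subgroup.zpowers (b ^ m)) : f z ∈ Subgroup.zpowers (f b ^ m) := by
  obtain ⟨k, rfl⟩ := Subgroup.mem_zpowers_iff.1 h
  exact Subgroup.mem_zpowers_iff.2 ⟨k, by simp only [map_zpow, map_pow]⟩

theorem LeftCosetRel.map {G : Type*} [Group G] (f : MulAut G) (m : ℕ) (x y : G × G)
    (h : LeftCosetRel G m x y) : LeftCosetRel G m (f x.1, f x.2) (f y.1, f y.2) := by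
  rcases h with ⟨h1, h2⟩ | ⟨h1, h2, b, h3, h4, h5⟩
  · exact Or.inl ⟨by simp [h1], by simp [h2]⟩
  · refine Or.inr ⟨by simpa using h1, by simpa using h2, f b, elemCentralizer_map f h3,
      elemCentralizer_map f h4, ?_⟩
    simpa only [map_mul, map_inv] using map_mem_zpowers_pow f h5

theorem RightCosetRel.map {G : Type*} [Group G] (f : MulAut G) (m : ℕ) (x y : G × G)
    (h : RightCosetRel G m x y) : RightCosetRel G m (f x.1, f x.2) (f y.1, f y.2) := by
  rcases h with ⟨h1, h2⟩ | ⟨h1, h2, b, h3, h4, h5⟩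
  · exact Or.inl ⟨by simp [h1], by simp [h2]⟩
  · refine Or.inr ⟨by simpa using h1, by simpa using h2, f b, elemCentralizer_map f h3,
      elemCentralizer_map f h4, ?_⟩
    simpa only [map_mul, map_inv] using map_mem_zpowers_pow f h5

theorem DoubleCosetRel.map {G : Type*} [Group G] (f : MulAut G) (m n : ℕ) (x y : G × G × G)
    (h : DoubleCosetRel G m n x y) :
    DoubleCosetRel G m n (f x.1, f x.2.1, f x.2.2) (f y.1, f y.2.1, f y.2.2) := by
  rcases h with ⟨h1, h2⟩ | ⟨h1, h2, h3, h4, a, c, h5, h6, h7, h8, γ, hγ, ε, hε, h9⟩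
  · exact Or.inl ⟨by simpa using h1, by simpa using h2⟩
  · refine Or.inr ⟨by simpa using h1, by simpa using h2, by simpa using h3, by simpa using h4,
      f a, f c, elemCentralizer_map f h5, elemCentralizer_map f h6, elemCentralizer_map f h7,
      elemCentralizer_map f h8, f γ, map_mem_zpowers_pow f hγ, f ε,
      map_mem_zpowers_pow f hε, ?_⟩
    simp only [← h9, map_mul]

/-- The elements of the expansion `G^we` of `G` by the basic sorts: elements of the home sort `G`,
conjugacy classes, and classes of the `m`-left-coset, `m`-right-coset and `m,n`-double-coset
relations, for all `m` and `n`. -/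
inductive WE (G : Type*) [Group G]
  | home (g : G) : WE G
  | conj (β : ConjClasses G) : WE G
  | leftCoset (m : ℕ) (β : Quot (LeftCosetRel G m)) : WE G
  | rightCoset (m : ℕ) (β : Quot (RightCosetRel G m)) : WE G
  | doubleCoset (m n : ℕ) (β : Quot (DoubleCosetRel G m n)) : WE G

namespace WE

/-- The canonical action of an automorphism of `G` on `G^we`. -/
def map {G : Type*} [Group G] (f : MulAut G) : WE G → WE G
  | home g => home (f g)
  | conj β => conj (ConjClasses.map (f : G →* G) β)
  | leftCoset m β =>
      leftCoset m (Quot.map (fun x => (f x.1, f x.2)) (LeftCosetRel.map f m) β)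
  | rightCoset m β =>
      rightCoset m (Quot.map (fun x => (f x.1, f x.2)) (RightCosetRel.map f m) β)
  | doubleCoset m n β =>
      doubleCoset m n
        (Quot.map (fun x => (f x.1, f x.2.1, f x.2.2)) (DoubleCosetRel.map f m n) β)

/-- The canonical action of `Aut(G)` on `G^we`. -/
instance {G : Type*} [Group G] : MulAction (MulAut G) (WE G) where
  smul f β := map f β
  one_smul := by
    rintro (g | ⟨⟨g⟩⟩ | ⟨m, ⟨x⟩⟩ | ⟨m, ⟨x⟩⟩ | ⟨m, n, ⟨x⟩⟩) <;> rfl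
  mul_smul := by
    rintro f g (h | ⟨⟨h⟩⟩ | ⟨m, ⟨x⟩⟩ | ⟨m, ⟨x⟩⟩ | ⟨m, n, ⟨x⟩⟩) <;> rfl

/-- For an embedding `i : G → H`, the predicate on `H^we` of lying in `G^we`, i.e. of being the
class of a tuple of elements of `G`. -/
inductive ComesFrom {G H : Type*} [Group G] [Group H] (i : G →* H) : WE H → Prop
  | home (a : G) : ComesFrom i (home (i a))
  | conj (a : G) : ComesFrom i (conj (ConjClasses.mk (i a)))
  | leftCoset (m : ℕ) (a b : G) : ComesFrom i (leftCoset m (Quot.mk _ (i a, i b)))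
  | rightCoset (m : ℕ) (a b : G) : ComesFrom i (rightCoset m (Quot.mk _ (i a, i b)))
  | doubleCoset (m n : ℕ) (a b c : G) :
      ComesFrom i (doubleCoset m n (Quot.mk _ (i a, i b, i c)))

/-- The trivial element of a sort is the class of the tuple all of whose entries are `1`. -/
inductive IsTrivial {G : Type*} [Group G] : WE G → Prop
  | home : IsTrivial (home 1)
  | conj : IsTrivial (conj (ConjClasses.mk 1))
  | leftCoset (m : ℕ) : IsTrivial (leftCoset m (Quot.mk _ (1, 1)))
  | rightCoset (m : ℕ) : IsTrivial (rightCoset m (Quot.mk _ (1, 1)))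
  | doubleCoset (m n : ℕ) : IsTrivial (doubleCoset m n (Quot.mk _ (1, 1, 1)))

end WE

/-- The free product `G * ⟨e⟩` of `G` with an infinite cyclic group. -/
abbrev AdjoinFree (G : Type*) [Group G] : Type _ :=
  Monoid.Coprod G (Multiplicative ℤ)

namespace AdjoinFree

/-- The embedding of `G` in `G * ⟨e⟩`. -/
def ofBase {G : Type*} [Group G] : G →* AdjoinFree G := Monoid.Coprod.inl

/-- The free generator `e`. -/
def e {G : Type*} [Group G] : AdjoinFree G := Monoid.Coprod.inr (Multiplicative.ofAdd 1)

/-- The endomorphism of `G * ⟨e⟩` that is the identity on `G` and sends `e` to `e a`. -/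
def shiftHom {G : Type*} [Group G] (a : G) : AdjoinFree G →* AdjoinFree G :=
  Monoid.Coprod.lift ofBase (zpowersHom (AdjoinFree G) (e * ofBase a))

theorem shiftHom_ofBase {G : Type*} [Group G] (a g : G) :
    shiftHom a (ofBase g) = ofBase g := rfl

theorem shiftHom_e {G : Type*} [Group G] (a : G) :
    shiftHom a e = e * ofBase a := by
  simp [shiftHom, e]

theorem shiftHom_comp {G : Type*} [Group G] {a b : G} (h : a * b = 1) :
    (shiftHom a).comp (shiftHom b) = MonoidHom.id (AdjoinFree G) := by
  refine Monoid.Coprod.hom_ext rfl (MonoidHom.ext_mint ?_)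
  change shiftHom a (shiftHom b e) = e
  rw [shiftHom_e, map_mul, shiftHom_e, shiftHom_ofBase, mul_assoc, ← map_mul, h, map_one, mul_one]

/-- The automorphism `f_a` of `G * ⟨e⟩` that is the identity on `G` and sends `e` to `e a`. -/
def shift {G : Type*} [Group G] (a : G) : MulAut (AdjoinFree G) :=
  MonoidHom.toMulEquiv (shiftHom a) (shiftHom a⁻¹) (shiftHom_comp (inv_mul_cancel a))
    (shiftHom_comp (mul_inv_cancel a))

theorem shift_ofBase {G : Type*} [Group G] (a g : G) :
    shift a (ofBase g) = ofBase g := rfl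

theorem shift_e {G : Type*} [Group G] (a : G) :
    shift a e = e * ofBase a := shiftHom_e a

end AdjoinFree

/-- `G` is the (internal) free product of its nontrivial subgroups `A` and `B`. -/
def IsNontrivialFreeProduct {G : Type*} [Group G] (A B : Subgroup G) : Prop :=
  A ≠ ⊥ ∧ B ≠ ⊥ ∧ Function.Bijective (Monoid.Coprod.lift A.subtype B.subtype)

/-!
In a torsion-free hyperbolic group, each element of the centralizer of `g ≠ 1` is a power of `g`
times an element of bounded length. So `⟨g⟩` has finite index in the centralizer, the centralizer
is central-by-finite, and by the transfer homomorphism it is abelian. Hence commuting is transitive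
on nontrivial elements, which is all that is used of hyperbolicity.

If the orbit of `β` under `⟨f_a, f_c⟩` is finite, then powers of `f_a` and `f_c` fix `β`; these are
`f_s` and `f_t` for powers `s` of `a` and `t` of `c`, which do not commute. Now `f_s` maps `e` to
`es` and `e⁻¹` to `s⁻¹e⁻¹`. In a normal form in `G * ⟨e⟩` it alters every letter from `G` between
two occurrences of `e^{±1}`, except those between `e⁻¹` and `e` and those between `e` and `e⁻¹`
that commute with `s`; a letter that commutes with both `s` and `t` is trivial, so that it cannot
separate `e` from `e⁻¹`. Also, `f_s` alters a letter in front of a first `e⁻¹` and behind a last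
`e`. So a normal form that is unaltered by `f_s` and `f_t` contains no `e`. For double cosets,
`f_s` may multiply the normal form by elements of `G` on both sides, but these come from a
centralizer and commute for `s` and `t`. For conjugacy classes, the normal form is a cyclic word
and its letters may be rotated, which a further power of `f_s` undoes.

If `G = A * B`, the elements of `G^{we}` in question leave `G^{we}` under conjugation by `e`, or,
for conjugacy classes, under the automorphism that conjugates only `B` by `e`.
-/

section FourPoint

variable {V : Type*} {Γ : SimpleGraph V} {δ D : ℕ} {f : V → V} {x y p : V}

theorem exists_dist_eq_of_dist_eq_add (hΓ : Γ.Connected) {j k : ℕ} (h : Γ.dist x y = j + k) :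
    ∃ p, Γ.dist x p = j ∧ Γ.dist p y = k := by
  obtain ⟨w, hw⟩ := hΓ.exists_walk_length_eq_dist x y
  have htake := Γ.dist_le (w.take j)
  have hdrop := Γ.dist_le (w.drop j)
  have htriangle := hΓ.dist_triangle (u := x) (v := w.getVert j) (w := y)
  rw [SimpleGraph.Walk.take_length] at htake
  rw [SimpleGraph.Walk.drop_length] at hdrop
  exact ⟨w.getVert j, by omega, by omega⟩

/-- Gromov's four-point condition with constant `δ` for the path metric of a graph; it is the
hyperbolicity condition in `IsHyperbolicGroup`. -/
def FourPointCondition {V : Type*} (Γ : SimpleGraph V) (δ : ℕ) : Prop :=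
  ∀ x y z w : V,
    Γ.dist x y + Γ.dist z w ≤ max (Γ.dist x z + Γ.dist y w) (Γ.dist x w + Γ.dist y z) + δ

theorem FourPointCondition.dist_apply_le (hδ : FourPointCondition Γ δ) (hΓ : Γ.Connected)
    (hf : ∀ u v, Γ.dist (f u) (f v) = Γ.dist u v) (hx : Γ.dist x (f x) ≤ D)
    (hy : Γ.dist y (f y) ≤ D) (hp : Γ.dist x p + Γ.dist p y = Γ.dist x y) :
    Γ.dist p (f p) ≤ D + δ := by
  have hquad := hδ x y p (f p)
  have hxfp := hΓ.dist_triangle (u := x) (v := f x) (w := f p)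
  have hyfp := hΓ.dist_triangle (u := y) (v := f y) (w := f p)
  rw [hf] at hxfp hyfp
  rw [SimpleGraph.dist_comm (u := y) (v := p)] at hquad hyfp
  omega

/-- If `f` moves `p` a lot, then it moves `p` along the geodesic from `x` to `y`, towards one of
the endpoints, which brings that endpoint closer to the translate of the other one. -/
theorem FourPointCondition.dist_apply_le_two_mul (hδ : FourPointCondition Γ δ)
    (hΓ : Γ.Connected) (hf : ∀ u v, Γ.dist (f u) (f v) = Γ.dist u v)
    (hx : Γ.dist x (f x) ≤ D) (hy : Γ.dist y (f y) ≤ D)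
    (hxfy : Γ.dist x y ≤ Γ.dist x (f y)) (hfxy : Γ.dist x y ≤ Γ.dist (f x) y)
    (hp : Γ.dist x p + Γ.dist p y = Γ.dist x y) (hxp : 2 * D + 2 * δ < Γ.dist x p)
    (hpy : 2 * D + 2 * δ < Γ.dist p y) : Γ.dist p (f p) ≤ 2 * δ := by
  have hnear := hδ.dist_apply_le hΓ hf hx hy hp
  have hquad := hδ x y p (f p)
  have hquad_x := hδ x (f p) (f x) p
  have hquad_y := hδ y (f p) (f y) p
  have hfx := hΓ.dist_triangle (u := f x) (v := p) (w := y)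
  have hfy := hΓ.dist_triangle (u := x) (v := p) (w := f y)
  rw [SimpleGraph.dist_comm (u := f p) (v := p), SimpleGraph.dist_comm (u := f p) (v := f x),
    hf] at hquad_x
  rw [SimpleGraph.dist_comm (u := f y) (v := p), SimpleGraph.dist_comm (u := f p) (v := p), hf,
    SimpleGraph.dist_comm (u := y) (v := p)] at hquad_y
  rw [SimpleGraph.dist_comm (u := y) (v := p)] at hquad
  omega

end FourPoint

section CayleyGraph

open SimpleGraph (mulCayley)

variable {G : Type*} [Group G] {S : Set G}

theorem mulCayley_connected (hS : Subgroup.closure S = ⊤) : (mulCayley S).Connected := by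
  have hreach (g : G) : ∀ u : G, (mulCayley S).Reachable u (u * g) := by
    have hg : g ∈ Subgroup.closure S := hS ▸ Subgroup.mem_top g
    induction hg using Subgroup.closure_induction with
    | mem s hs =>
      intro u
      by_cases h : u = u * s
      · rw [← h]
      · exact ((SimpleGraph.mulCayley_adj S _ _).2 ⟨h, .inl (by simpa using hs)⟩).reachable
    | one => simp
    | mul x y _ _ hx hy => exact fun u => mul_assoc u x y ▸ (hx u).trans (hy _)
    | inv x _ hx => exact fun u => by simpa using (hx (u * x⁻¹)).symm
  have : Nonempty G := ⟨1⟩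
  exact ⟨fun u v => by simpa using hreach (u⁻¹ * v) u⟩

theorem mulCayley_dist_mul_left (hS : Subgroup.closure S = ⊤) (g u v : G) :
    (mulCayley S).dist (g * u) (g * v) = (mulCayley S).dist u v := by
  have hle (g u v : G) : (mulCayley S).dist (g * u) (g * v) ≤ (mulCayley S).dist u v := by
    obtain ⟨w, hw⟩ := (mulCayley_connected hS).exists_walk_length_eq_dist u v
    let mulLeft : mulCayley S →g mulCayley S :=
      ⟨(g * ·), SimpleGraph.mulCayley_adj_mul_iff_right.2⟩
    exact ((mulCayley S).dist_le (w.map mulLeft)).trans_eq ((w.length_map mulLeft).trans hw)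
  exact le_antisymm (hle g u v) (by simpa using hle g⁻¹ (g * u) (g * v))

theorem mulCayley_dist_mul_right (hS : Subgroup.closure S = ⊤) (u g : G) :
    (mulCayley S).dist u (u * g) = (mulCayley S).dist 1 g := by
  simpa using mulCayley_dist_mul_left hS u 1 g

theorem mulCayley_dist_one_inv_mul (hS : Subgroup.closure S = ⊤) (u v : G) :
    (mulCayley S).dist 1 (u⁻¹ * v) = (mulCayley S).dist u v := by
  simpa using (mulCayley_dist_mul_left hS u 1 (u⁻¹ * v)).symm

theorem finite_mulCayley_closedBall (hS : Subgroup.closure S = ⊤) (hfin : S.Finite) (n : ℕ) :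
    {x : G | (mulCayley S).dist 1 x ≤ n}.Finite := by
  have hconn := mulCayley_connected hS
  induction n with
  | zero =>
    refine (Set.finite_singleton (1 : G)).subset fun x hx => ?_
    exact (hconn.dist_eq_zero_iff.1 (Nat.le_zero.1 hx)).symm
  | succ n ih =>
    refine (ih.union (ih.image2 (· * ·) (hfin.union hfin.inv))).subset fun x hx => ?_
    rcases Nat.le_add_one_iff.1 hx with hx | hx
    · exact .inl hx
    · obtain ⟨w, hw, hwx⟩ := exists_dist_eq_of_dist_eq_add hconn hx
      rw [SimpleGraph.dist_eq_one_iff_adj, SimpleGraph.mulCayley_adj] at hwx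
      exact .inr ⟨w, hw.le, w⁻¹ * x, hwx.2.imp id (by simp), mul_inv_cancel_left w x⟩

variable {δ : ℕ} {k h p : G}

theorem FourPointCondition.mulCayley_dist_mul_le (hδ : FourPointCondition (mulCayley S) δ)
    (hS : Subgroup.closure S = ⊤) (hkh : Commute k h)
    (hp : (mulCayley S).dist 1 p + (mulCayley S).dist p h = (mulCayley S).dist 1 h) :
    (mulCayley S).dist p (k * p) ≤ (mulCayley S).dist 1 k + δ :=
  hδ.dist_apply_le (mulCayley_connected hS) (mulCayley_dist_mul_left hS k)
    (by rw [mul_one]) (by rw [hkh.eq, mulCayley_dist_mul_right hS]) hp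

theorem FourPointCondition.mulCayley_dist_mul_le_two_mul
    (hδ : FourPointCondition (mulCayley S) δ) (hS : Subgroup.closure S = ⊤)
    (hkh : Commute k h)
    (hk : (mulCayley S).dist 1 h ≤ (mulCayley S).dist 1 (k * h))
    (hk' : (mulCayley S).dist 1 h ≤ (mulCayley S).dist 1 (k⁻¹ * h))
    (hp : (mulCayley S).dist 1 p + (mulCayley S).dist p h = (mulCayley S).dist 1 h)
    (hp₁ : 2 * (mulCayley S).dist 1 k + 2 * δ < (mulCayley S).dist 1 p)
    (hp₂ : 2 * (mulCayley S).dist 1 k + 2 * δ < (mulCayley S).dist p h) :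
    (mulCayley S).dist p (k * p) ≤ 2 * δ := by
  rw [mulCayley_dist_one_inv_mul hS] at hk'
  exact hδ.dist_apply_le_two_mul (mulCayley_connected hS) (mulCayley_dist_mul_left hS k)
    (by rw [mul_one]) (by rw [hkh.eq, mulCayley_dist_mul_right hS]) hk (by rwa [mul_one]) hp
    hp₁ hp₂

end CayleyGraph

section CommutativeTransitive

variable {G : Type*} [Group G]

theorem exists_pow_notMem (htf : IsTorsionFreeGroup G) {F B : Set G} (hF : F.Finite)
    (hB : B.Finite) : ∃ N : ℕ, ∀ f ∈ F, f ≠ 1 → f ^ N ∉ B := by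
  have hbad : (⋃ f ∈ F \ {1}, {N : ℕ | f ^ N ∈ B}).Finite :=
    hF.sdiff.biUnion fun f hf =>
      hB.preimage (injective_pow_iff_not_isOfFinOrder.2 (htf f hf.2)).injOn
  obtain ⟨N, hN⟩ := hbad.infinite_compl.nonempty
  exact ⟨N, fun f hf hf1 hfN => hN (Set.mem_biUnion ⟨hf, hf1⟩ hfN)⟩

/-- A shortest element `h` of the coset `⟨g⟩x` is short: otherwise all powers of `g` move the
middle of the geodesic from `1` to `h` by at most `2δ`, while `N` is chosen so that `g ^ N` moves
it further. -/
theorem FourPointCondition.exists_forall_commute_dist_zpow_mul_le {S : Set G} {δ : ℕ}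
    (hδ : FourPointCondition (SimpleGraph.mulCayley S) δ) (hS : Subgroup.closure S = ⊤)
    (hfin : S.Finite) (htf : IsTorsionFreeGroup G) {g : G} (hg : g ≠ 1) :
    ∃ R : ℕ, ∀ x : G, Commute g x →
      ∃ z : ℤ, (SimpleGraph.mulCayley S).dist 1 (g ^ z * x) ≤ R := by
  set d := (SimpleGraph.mulCayley S).dist
  obtain ⟨N, hN⟩ := exists_pow_notMem htf (finite_mulCayley_closedBall hS hfin (d 1 g + δ))
    (finite_mulCayley_closedBall hS hfin (2 * δ))
  set M := 2 * d 1 (g ^ N) + 2 * δ + 1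
  refine ⟨2 * M, fun x hx => ?_⟩
  let z := Function.argmin fun z : ℤ => d 1 (g ^ z * x)
  have hz (z' : ℤ) : d 1 (g ^ z * x) ≤ d 1 (g ^ z' * x) :=
    Function.argmin_le (fun z : ℤ => d 1 (g ^ z * x)) z'
  refine ⟨z, ?_⟩
  set h := g ^ z * x
  have hgh : Commute g h := ((Commute.refl g).zpow_right z).mul_right hx
  by_contra! hlong
  obtain ⟨p, hp₁, hp₂⟩ : ∃ p, d 1 p = M ∧ d p h = d 1 h - M :=
    exists_dist_eq_of_dist_eq_add (mulCayley_connected hS)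
      (show d 1 h = M + (d 1 h - M) by omega)
  have hp : d 1 p + d p h = d 1 h := by omega
  have hfar₁ : 2 * d 1 (g ^ N) + 2 * δ < d 1 p := by omega
  have hfar₂ : 2 * d 1 (g ^ N) + 2 * δ < d p h := by omega
  have hgp : d 1 (p⁻¹ * (g * p)) ≤ d 1 g + δ :=
    (mulCayley_dist_one_inv_mul hS p _).trans_le (hδ.mulCayley_dist_mul_le hS hgh hp)
  have hgNp : d 1 (p⁻¹ * (g ^ N * p)) ≤ 2 * δ := by
    refine (mulCayley_dist_one_inv_mul hS p _).trans_le
      (hδ.mulCayley_dist_mul_le_two_mul hS (hgh.pow_left N) ?_ ?_ hp hfar₁ hfar₂)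
    · simpa [zpow_add, mul_assoc] using hz (N + z)
    · simpa [zpow_add, mul_assoc] using hz (-N + z)
  have hconj : (p⁻¹ * (g * p)) ^ N = p⁻¹ * (g ^ N * p) := by
    simpa [mul_assoc] using conj_pow (a := p⁻¹) (b := g) (i := N)
  exact hN _ hgp (by simpa [inv_mul_eq_iff_eq_mul] using hg) (hconj ▸ hgNp)

open scoped commutatorElement in
theorem commute_of_finiteIndex_center (htf : IsTorsionFreeGroup G)
    [(Subgroup.center G).FiniteIndex] (x y : G) : Commute x y := by
  have htransfer : MonoidHom.transferCenterPow G ⁅x, y⁆ = 1 := by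
    rw [map_commutatorElement, commutatorElement_eq_one_iff_mul_comm]
    exact Subtype.ext (Subgroup.mem_center_iff.1 (Subtype.property _) _)
  have hpow : ⁅x, y⁆ ^ (Subgroup.center G).index = 1 := by
    rw [← MonoidHom.transferCenterPow_apply, htransfer, Subgroup.coe_one]
  rw [← commutatorElement_eq_one_iff_commute]
  by_contra hne
  exact htf _ hne (isOfFinOrder_iff_pow_eq_one.2
    ⟨_, Nat.pos_of_ne_zero Subgroup.FiniteIndex.index_ne_zero, hpow⟩)

theorem IsTorsionFreeGroup.subgroup (htf : IsTorsionFreeGroup G) (H : Subgroup G) :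
    IsTorsionFreeGroup H :=
  fun h hh hfin => htf h (by simpa using hh) (H.subtype.isOfFinOrder hfin)

theorem finiteIndex_center_of_forall_exists_mul_mem {B : Set G} (hB : B.Finite)
    (hcover : ∀ x : G, ∃ c ∈ Subgroup.center G, c * x ∈ B) :
    (Subgroup.center G).FiniteIndex := by
  have := hB.to_subtype
  have : Finite (G ⧸ Subgroup.center G) :=
    Finite.of_surjective (fun b : B => (b : G ⧸ Subgroup.center G)) fun q => by
      obtain ⟨x, rfl⟩ := QuotientGroup.mk_surjective q
      obtain ⟨c, hc, hcx⟩ := hcover x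
      refine ⟨⟨c * x, hcx⟩, QuotientGroup.eq.2 ?_⟩
      simpa [← Subgroup.mem_center_iff.1 hc x] using hc
  exact Subgroup.finiteIndex_of_finite_quotient

/-- A group is commutative transitive if commuting is a transitive relation on its nontrivial
elements. -/
def IsCommutativeTransitive (G : Type*) [Group G] : Prop :=
  ∀ ⦃g x y : G⦄, g ≠ 1 → Commute g x → Commute g y → Commute x y

theorem IsCommutativeTransitive.eq_one_of_commute (hct : IsCommutativeTransitive G)
    {a c g : G} (hac : ¬ Commute a c) (ha : Commute a g) (hc : Commute c g) : g = 1 := by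
  by_contra hg
  exact hac (hct hg ha.symm hc.symm)

theorem IsCommutativeTransitive.not_commute_of_elemCentralizer_ne (hct : IsCommutativeTransitive G)
    {a c : G} (ha : a ≠ 1) (hc : c ≠ 1) (h : elemCentralizer a ≠ elemCentralizer c) :
    ¬ Commute a c := fun hac => h <| by
  ext g
  rw [Subgroup.mem_centralizer_singleton_iff, Subgroup.mem_centralizer_singleton_iff]
  exact ⟨fun hg => hct ha (.symm hg) hac, fun hg => hct hc (.symm hg) hac.symm⟩

theorem IsHyperbolicGroup.isCommutativeTransitive (hG : IsHyperbolicGroup G)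
    (htf : IsTorsionFreeGroup G) : IsCommutativeTransitive G := by
  obtain ⟨S, hS, δ, hδ⟩ := hG
  intro g x y hg hx hy
  obtain ⟨R, hR⟩ := FourPointCondition.exists_forall_commute_dist_zpow_mul_le hδ hS
    S.finite_toSet htf hg
  let C := elemCentralizer g
  have hC {z : G} : z ∈ C ↔ Commute g z := by
    rw [Subgroup.mem_centralizer_singleton_iff, eq_comm]; rfl
  have : (Subgroup.center C).FiniteIndex := by
    refine finiteIndex_center_of_forall_exists_mul_mem
      ((finite_mulCayley_closedBall hS S.finite_toSet R).preimage Subtype.val_injective.injOn)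
      fun c => ?_
    obtain ⟨z, hz⟩ := hR c (hC.1 c.2)
    refine ⟨⟨g, hC.2 (.refl g)⟩ ^ z, zpow_mem (Subgroup.mem_center_iff.2 fun c => ?_) z, hz⟩
    exact Subtype.ext (hC.1 c.2).eq.symm
  exact congrArg Subtype.val
    (commute_of_finiteIndex_center (htf.subgroup C) ⟨x, hC.2 hx⟩ ⟨y, hC.2 hy⟩).eq

end CommutativeTransitive

namespace AdjoinFree

section Words

variable {G : Type*} [Group G] {ε ν : ℤˣ} {g : G} {l : List (ℤˣ × G)}

/-- The product `e ^ ε₁ * g₁ * ⋯ * e ^ εₖ * gₖ` of a list of letters `(εᵢ, gᵢ)`. -/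
def wordProd (l : List (ℤˣ × G)) : AdjoinFree G :=
  (l.map fun p => e ^ (p.1 : ℤ) * ofBase p.2).prod

@[simp]
theorem wordProd_nil : wordProd ([] : List (ℤˣ × G)) = 1 := rfl

@[simp]
theorem wordProd_cons (p : ℤˣ × G) (l : List (ℤˣ × G)) :
    wordProd (p :: l) = e ^ (p.1 : ℤ) * ofBase p.2 * wordProd l := by
  simp [wordProd]

@[simp]
theorem wordProd_append (l l' : List (ℤˣ × G)) :
    wordProd (l ++ l') = wordProd l * wordProd l' := by
  simp [wordProd]

/-- The letters `p` and `q` may follow each other in a reduced word: they do not read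
`e ^ ε * 1 * e ^ (-ε)`. -/
def NoCancel (p q : ℤˣ × G) : Prop := p.2 = 1 → p.1 = q.1

/-- Reduced words, the normal forms in `G * ⟨e⟩` up to a factor from `G` on the left. -/
abbrev IsReduced (l : List (ℤˣ × G)) : Prop := l.IsChain NoCancel

theorem isReduced_concat_iff (g' : G) :
    IsReduced (l ++ [(ε, g)]) ↔ IsReduced (l ++ [(ε, g')]) := by
  simp [IsReduced, List.isChain_append, NoCancel]

/-- `G * ⟨e⟩` as the HNN extension of `G` along its trivial subgroup, from which it inherits
normal forms. -/
def hnnEquiv (G : Type*) [Group G] :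
    AdjoinFree G ≃* HNNExtension G (⊥ : Subgroup G) (⊥ : Subgroup G) (MulEquiv.refl _) :=
  MonoidHom.toMulEquiv
    (Monoid.Coprod.lift HNNExtension.of (zpowersHom _ HNNExtension.t))
    (HNNExtension.lift ofBase e fun u => by simp [Subgroup.mem_bot.1 u.2])
    (Monoid.Coprod.hom_ext (by ext; simp [ofBase]) (MonoidHom.ext_mint (by simp [e])))
    (HNNExtension.hom_ext (by ext; simp [ofBase]) (by simp [e]))

@[simp]
theorem hnnEquiv_ofBase (g : G) : hnnEquiv G (ofBase g) = HNNExtension.of g := rfl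

@[simp]
theorem hnnEquiv_e : hnnEquiv G e = HNNExtension.t := by
  simp [hnnEquiv, e]

/-- All of `G`, as a transversal of its trivial subgroup. -/
def univTransversal (G : Type*) [Group G] :
    HNNExtension.NormalWord.TransversalPair G (⊥ : Subgroup G) (⊥ : Subgroup G) where
  set _ := Set.univ
  compl u := by
    simpa [HNNExtension.toSubgroup] using Subgroup.isComplement_singleton_univ

theorem isReduced_iff_isChain_mem_toSubgroup : IsReduced l ↔ l.IsChain fun p q =>
    p.2 ∈ HNNExtension.toSubgroup (⊥ : Subgroup G) (⊥ : Subgroup G) p.1 → p.1 = q.1 := by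
  change l.IsChain (fun p q => p.2 = 1 → p.1 = q.1) ↔ _
  simp [HNNExtension.toSubgroup]

theorem hnnEquiv_ofBase_mul_wordProd (w : HNNExtension.NormalWord.ReducedWord G
    (⊥ : Subgroup G) (⊥ : Subgroup G)) :
    hnnEquiv G (ofBase w.head * wordProd w.toList) = w.prod (MulEquiv.refl _) := by
  simp [HNNExtension.NormalWord.ReducedWord.prod, wordProd, map_list_prod, Function.comp_def]

theorem exists_eq_ofBase_mul_wordProd (x : AdjoinFree G) :
    ∃ (g : G) (l : List (ℤˣ × G)), IsReduced l ∧ x = ofBase g * wordProd l := by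
  obtain ⟨w, hw⟩ := (HNNExtension.NormalWord.equiv (MulEquiv.refl (⊥ : Subgroup G))
    (univTransversal G)).symm.surjective (hnnEquiv G x)
  refine ⟨w.head, w.toList, isReduced_iff_isChain_mem_toSubgroup.2 w.chain,
    (hnnEquiv G).injective ?_⟩
  exact hw.symm.trans (hnnEquiv_ofBase_mul_wordProd w.toReducedWord).symm

theorem IsReduced.ofBase_mul_wordProd_inj {g' : G} {l' : List (ℤˣ × G)} (hl : IsReduced l)
    (hl' : IsReduced l') (h : ofBase g * wordProd l = ofBase g' * wordProd l') :
    g = g' ∧ l = l' := by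
  let normalWord (g : G) {l : List (ℤˣ × G)} (hl : IsReduced l) :
      HNNExtension.NormalWord (univTransversal G) :=
    ⟨⟨g, l, isReduced_iff_isChain_mem_toSubgroup.1 hl⟩, fun _ _ _ => Set.mem_univ _⟩
  have hnormal : normalWord g hl = normalWord g' hl' := by
    refine HNNExtension.NormalWord.prod_injective (MulEquiv.refl _) _ ?_
    exact ((hnnEquiv_ofBase_mul_wordProd (normalWord g hl).toReducedWord).symm.trans
      (congrArg _ h)).trans (hnnEquiv_ofBase_mul_wordProd (normalWord g' hl').toReducedWord)
  exact ⟨congrArg (·.head) hnormal, congrArg (·.toList) hnormal⟩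

theorem exists_mul_ofBase_eq (g₀ g : G) (hl : IsReduced l) :
    ∃ g₁ l₁, IsReduced l₁ ∧ l₁.length = l.length ∧
      ofBase g₀ * wordProd l * ofBase g = ofBase g₁ * wordProd l₁ := by
  rcases List.eq_nil_or_concat' l with rfl | ⟨l, ⟨ε, h⟩, rfl⟩
  · exact ⟨g₀ * g, [], hl, rfl, by simp⟩
  · exact ⟨g₀, l ++ [(ε, h * g)], (isReduced_concat_iff _).1 hl, by simp, by simp [mul_assoc]⟩

theorem mem_range_ofBase_or_exists_concat (x : AdjoinFree G) :
    x ∈ (ofBase : G →* AdjoinFree G).range ∨ ∃ (g g' : G) (l : List (ℤˣ × G)) (ε : ℤˣ),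
      IsReduced (l ++ [(ε, 1)]) ∧ x = ofBase g * wordProd (l ++ [(ε, 1)]) * ofBase g' := by
  obtain ⟨g, l, hl, rfl⟩ := exists_eq_ofBase_mul_wordProd x
  rcases List.eq_nil_or_concat' l with rfl | ⟨l, ⟨ε, g'⟩, rfl⟩
  · exact .inl ⟨g, by simp⟩
  · exact .inr ⟨g, g', l, ε, (isReduced_concat_iff _).1 hl, by simp [mul_assoc]⟩

theorem ofBase_injective : Function.Injective (ofBase : G →* AdjoinFree G) :=
  Monoid.Coprod.inl_injective

theorem mem_range_ofBase_of_mul_eq_mul {z : AdjoinFree G} {g g' : G} (hg : g ≠ 1)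
    (h : z * ofBase g = ofBase g' * z) : z ∈ (ofBase : G →* AdjoinFree G).range := by
  refine (mem_range_ofBase_or_exists_concat z).resolve_right ?_
  rintro ⟨g₀, g₁, l, ε, hl, rfl⟩
  have hconcat : ofBase g₀ * wordProd (l ++ [(ε, g₁ * g)]) =
      ofBase (g' * g₀) * wordProd (l ++ [(ε, g₁)]) := by
    simpa [mul_assoc] using h
  have := (IsReduced.ofBase_mul_wordProd_inj ((isReduced_concat_iff _).1 hl)
    ((isReduced_concat_iff _).1 hl) hconcat).2
  exact hg (by simpa using this)

theorem mem_range_ofBase_of_commute {z : AdjoinFree G} {g : G} (hg : g ≠ 1)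
    (h : Commute (ofBase g) z) : z ∈ (ofBase : G →* AdjoinFree G).range :=
  mem_range_ofBase_of_mul_eq_mul hg h.symm.eq

theorem e_notMem_range_ofBase : (e : AdjoinFree G) ∉ (ofBase : G →* AdjoinFree G).range := by
  rintro ⟨g, hg⟩
  have := (IsReduced.ofBase_mul_wordProd_inj (g := g) (g' := 1) (l' := [(1, 1)]) .nil
    (.singleton _) (by simpa using hg)).2
  simp at this

end Words

section Shift

variable {G : Type*}

/-- The sign of the first letter of a word that is followed by a letter of sign `ν`. -/
def nextSign (ν : ℤˣ) : List (ℤˣ × G) → ℤˣ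
  | [] => ν
  | p :: _ => p.1

@[simp]
theorem nextSign_concat (ν : ℤˣ) (l : List (ℤˣ × G)) (p : ℤˣ × G) :
    nextSign ν (l ++ [p]) = nextSign p.1 l := by
  cases l <;> rfl

variable [Group G] {l : List (ℤˣ × G)}

theorem shift_one : shift (1 : G) = 1 := by
  have : shiftHom (1 : G) = MonoidHom.id _ :=
    Monoid.Coprod.hom_ext rfl <| MonoidHom.ext_mint <|
      (shiftHom_e 1).trans <| by rw [map_one, mul_one]; rfl
  exact MulEquiv.ext fun x => DFunLike.congr_fun this x

theorem shift_mul (s t : G) : shift (s * t) = shift s * shift t := by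
  have : shiftHom (s * t) = (shiftHom s).comp (shiftHom t) := by
    refine Monoid.Coprod.hom_ext rfl (MonoidHom.ext_mint ?_)
    change shiftHom (s * t) e = shiftHom s (shiftHom t e)
    simp only [shiftHom_e, map_mul, shiftHom_ofBase, mul_assoc]
  exact MulEquiv.ext fun x => DFunLike.congr_fun this x

theorem shift_pow (s : G) (n : ℕ) : shift (s ^ n) = shift s ^ n := by
  induction n with
  | zero => simp only [pow_zero, shift_one]
  | succ n ih => rw [pow_succ, pow_succ, shift_mul, ih]

/-- The element of `G` that `shift s` puts in front of `e ^ ε`. -/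
def leftTwist (s : G) (ε : ℤˣ) : G := if ε = 1 then 1 else s⁻¹

/-- The element of `G` that `shift s` puts behind `e ^ ε`. -/
def rightTwist (s : G) (ε : ℤˣ) : G := if ε = 1 then s else 1

@[simp]
theorem leftTwist_one (s : G) : leftTwist s 1 = 1 := rfl

@[simp]
theorem leftTwist_neg_one (s : G) : leftTwist s (-1) = s⁻¹ := rfl

@[simp]
theorem rightTwist_one (s : G) : rightTwist s 1 = s := rfl

@[simp]
theorem rightTwist_neg_one (s : G) : rightTwist s (-1) = 1 := rfl

theorem shift_e_zpow (s : G) (ε : ℤˣ) : shift s (e ^ (ε : ℤ)) =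
    ofBase (leftTwist s ε) * e ^ (ε : ℤ) * ofBase (rightTwist s ε) := by
  rcases Int.units_eq_one_or ε with rfl | rfl <;> simp [shift_e]

/-- The effect of `shift s` on a word that is followed by a letter of sign `ν`: the element that
`shift s` puts in front of a power of `e` is moved to the preceding letter. -/
def shiftWord (s : G) (ν : ℤˣ) : List (ℤˣ × G) → List (ℤˣ × G)
  | [] => []
  | p :: l => (p.1, rightTwist s p.1 * p.2 * leftTwist s (nextSign ν l)) :: shiftWord s ν l

@[simp]
theorem nextSign_shiftWord (s : G) (μ ν : ℤˣ) (l : List (ℤˣ × G)) :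
    nextSign μ (shiftWord s ν l) = nextSign μ l := by
  cases l <;> rfl

theorem shiftWord_concat (s : G) (ν : ℤˣ) (l : List (ℤˣ × G)) (p : ℤˣ × G) :
    shiftWord s ν (l ++ [p]) =
      shiftWord s p.1 l ++ [(p.1, rightTwist s p.1 * p.2 * leftTwist s ν)] := by
  induction l with
  | nil => rfl
  | cons q l ih => simp [shiftWord, ih]

theorem shift_wordProd_mul_leftTwist (s : G) (ν : ℤˣ) (l : List (ℤˣ × G)) :
    shift s (wordProd l) * ofBase (leftTwist s ν) =
      ofBase (leftTwist s (nextSign ν l)) * wordProd (shiftWord s ν l) := by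
  induction l with
  | nil => simp [nextSign, shiftWord]
  | cons p l ih =>
    simp only [wordProd_cons, map_mul, shift_e_zpow, shift_ofBase, shiftWord, nextSign, mul_assoc,
      ih]

theorem NoCancel.twist {p q : ℤˣ × G} (h : NoCancel p q) (s : G) (g : G) :
    NoCancel (p.1, rightTwist s p.1 * p.2 * leftTwist s q.1) (q.1, g) := by
  obtain ⟨ε, h⟩ := p
  obtain ⟨ε', h'⟩ := q
  rcases Int.units_eq_one_or ε with rfl | rfl <;> rcases Int.units_eq_one_or ε' with rfl | rfl <;>
    simp_all [NoCancel, mul_inv_eq_one]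

theorem IsReduced.shiftWord (hl : IsReduced l) (s : G) (ν : ℤˣ) :
    IsReduced (shiftWord s ν l) := by
  induction l with
  | nil => exact .nil
  | cons p l ih =>
    cases l with
    | nil => exact .singleton _
    | cons q l =>
      rw [IsReduced, List.isChain_cons_cons] at hl
      exact List.isChain_cons_cons.2 ⟨hl.1.twist s _, ih hl.2⟩

theorem shiftWord_one (ν : ℤˣ) (l : List (ℤˣ × G)) : shiftWord 1 ν l = l := by
  induction l with
  | nil => rfl
  | cons p l ih => simp [shiftWord, ih, leftTwist, rightTwist]

theorem shiftWord_mul (s t : G) (ν : ℤˣ) (l : List (ℤˣ × G)) :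
    shiftWord (s * t) ν l = shiftWord s ν (shiftWord t ν l) := by
  have hleft (ε : ℤˣ) : leftTwist (s * t) ε = leftTwist t ε * leftTwist s ε := by
    rcases Int.units_eq_one_or ε with rfl | rfl <;> simp
  have hright (ε : ℤˣ) : rightTwist (s * t) ε = rightTwist s ε * rightTwist t ε := by
    rcases Int.units_eq_one_or ε with rfl | rfl <;> simp
  induction l with
  | nil => rfl
  | cons p l ih => simp [shiftWord, ih, hleft, hright, mul_assoc]

theorem shiftWord_pow (s : G) (n : ℕ) (ν : ℤˣ) :
    shiftWord (s ^ n) ν = (shiftWord s ν)^[n] := by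
  induction n with
  | zero => exact funext fun l => by rw [pow_zero, shiftWord_one, Function.iterate_zero, id]
  | succ n ih =>
    exact funext fun l => by rw [pow_succ, shiftWord_mul, ih, Function.iterate_succ_apply]

theorem shiftWord_injective (s : G) (ν : ℤˣ) : Function.Injective (shiftWord s ν) :=
  Function.LeftInverse.injective (g := shiftWord s⁻¹ ν) fun l => by
    rw [← shiftWord_mul, inv_mul_cancel, shiftWord_one]

end Shift

section FixedWords

variable {G : Type*} [Group G] {a c : G} {ε ν : ℤˣ} {l : List (ℤˣ × G)}

theorem eq_or_commute_of_twist_eq_self {s g : G} (hs : s ≠ 1)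
    (h : rightTwist s ε * g * leftTwist s ν = g) : (ε = -1 ∧ ν = 1) ∨ (ε ≠ ν ∧ Commute s g) := by
  rcases Int.units_eq_one_or ε with rfl | rfl <;> rcases Int.units_eq_one_or ν with rfl | rfl
  · simp [hs] at h
  · exact .inr ⟨by decide, mul_inv_eq_iff_eq_mul.1 h⟩
  · exact .inl ⟨rfl, rfl⟩
  · simp [hs] at h

theorem IsReduced.noCancel_nextSign {p : ℤˣ × G} {g : G}
    (hl : IsReduced (p :: l ++ [(ν, g)])) : NoCancel p (nextSign ν l, g) := by
  cases l with
  | nil => exact List.isChain_pair.1 hl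
  | cons q l => exact (List.isChain_cons_cons.1 hl).1

theorem sign_eq_of_shiftWord_cons_eq_self (hct : IsCommutativeTransitive G)
    (hac : ¬ Commute a c) {p : ℤˣ × G} {g : G} (hl : IsReduced (p :: l ++ [(ν, g)]))
    (ha : shiftWord a ν (p :: l) = p :: l) (hc : shiftWord c ν (p :: l) = p :: l) :
    p.1 = -1 ∧ nextSign ν l = 1 := by
  have ha1 : a ≠ 1 := fun h => hac (h ▸ .one_left c)
  have hc1 : c ≠ 1 := fun h => hac (h ▸ .one_right a)
  simp only [shiftWord, List.cons.injEq, Prod.ext_iff, true_and] at ha hc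
  rcases eq_or_commute_of_twist_eq_self ha1 ha.1 with h | ⟨hne, hap⟩
  · exact h
  · refine (eq_or_commute_of_twist_eq_self hc1 hc.1).resolve_right fun ⟨_, hcp⟩ => ?_
    exact hne (hl.noCancel_nextSign (hct.eq_one_of_commute hac hap hcp))

theorem eq_nil_or_eq_singleton_of_shiftWord_eq_self (hct : IsCommutativeTransitive G)
    (hac : ¬ Commute a c) {g : G} (hl : IsReduced (l ++ [(ν, g)]))
    (ha : shiftWord a ν l = l) (hc : shiftWord c ν l = l) :
    l = [] ∨ ν = 1 ∧ ∃ p, l = [p] ∧ p.1 = -1 := by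
  rcases l with - | ⟨p, l⟩
  · exact .inl rfl
  obtain ⟨hp, hnext⟩ := sign_eq_of_shiftWord_cons_eq_self hct hac hl ha hc
  rcases l with - | ⟨q, l⟩
  · exact .inr ⟨hnext, p, rfl, hp⟩
  have hq := (sign_eq_of_shiftWord_cons_eq_self hct hac (List.isChain_cons_cons.1 hl).2
    (List.cons.inj ha).2 (List.cons.inj hc).2).1
  exact absurd (hq.symm.trans hnext) (by decide)

theorem eq_twist_of_shift_wordProd_concat_eq_mul {s u v : G} (hl : IsReduced (l ++ [(ε, 1)]))
    (h : shift s (wordProd (l ++ [(ε, 1)])) = ofBase u * wordProd (l ++ [(ε, 1)]) * ofBase v) :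
    leftTwist s (nextSign ε l) = u ∧ shiftWord s ε l = l ∧ rightTwist s ε = v := by
  have hshift := shift_wordProd_mul_leftTwist s 1 (l ++ [(ε, 1)])
  rw [leftTwist_one, map_one, mul_one, h] at hshift
  have hword : ofBase (leftTwist s (nextSign ε l)) *
      wordProd (shiftWord s ε l ++ [(ε, rightTwist s ε)]) =
      ofBase u * wordProd (l ++ [(ε, v)]) := by
    simpa [shiftWord_concat, mul_assoc] using hshift.symm
  have hred := hl.shiftWord s 1
  rw [shiftWord_concat] at hred
  obtain ⟨hu, hlist⟩ := IsReduced.ofBase_mul_wordProd_inj ((isReduced_concat_iff _).1 hred)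
    ((isReduced_concat_iff _).1 hl) hword
  obtain ⟨hl, hv⟩ := List.append_inj' hlist rfl
  exact ⟨hu, hl, by simpa using hv⟩

theorem mem_range_ofBase_of_shift_eq_mul (hct : IsCommutativeTransitive G)
    (hac : ¬ Commute a c) {x : AdjoinFree G} {u u' v v' : G} (hu : Commute u u')
    (hv : Commute v v') (ha : shift a x = ofBase u * x * ofBase v)
    (hc : shift c x = ofBase u' * x * ofBase v') : x ∈ (ofBase : G →* AdjoinFree G).range := by
  refine (mem_range_ofBase_or_exists_concat x).resolve_right ?_
  rintro ⟨g, g', l, ε, hl, rfl⟩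
  have hconj {s u v : G} (h : shift s (ofBase g * wordProd (l ++ [(ε, 1)]) * ofBase g') =
      ofBase u * (ofBase g * wordProd (l ++ [(ε, 1)]) * ofBase g') * ofBase v) :
      shift s (wordProd (l ++ [(ε, 1)])) =
        ofBase (g⁻¹ * u * g) * wordProd (l ++ [(ε, 1)]) * ofBase (g' * v * g'⁻¹) := by
    rw [map_mul, map_mul, shift_ofBase, shift_ofBase] at h
    rw [mul_assoc, ← eq_inv_mul_iff_mul_eq, ← eq_mul_inv_iff_mul_eq] at h
    simp only [h, map_mul, map_inv, mul_assoc]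
  obtain ⟨hua, hla, hva⟩ := eq_twist_of_shift_wordProd_concat_eq_mul hl (hconj ha)
  obtain ⟨huc, hlc, hvc⟩ := eq_twist_of_shift_wordProd_concat_eq_mul hl (hconj hc)
  have hfirst : nextSign ε l = 1 := by
    refine (Int.units_eq_one_or _).resolve_right fun h => hac ?_
    rw [h, leftTwist_neg_one] at hua huc
    rw [← Commute.inv_inv_iff, hua, huc]
    simpa using (Commute.conj_iff g⁻¹).2 hu
  have hlast : ε = -1 := by
    refine (Int.units_eq_one_or _).resolve_left fun h => hac ?_
    rw [h, rightTwist_one] at hva hvc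
    exact hva ▸ hvc ▸ (Commute.conj_iff g').2 hv
  subst hlast
  rcases eq_nil_or_eq_singleton_of_shiftWord_eq_self hct hac hl hla hlc with rfl | ⟨hν, -⟩
  · exact absurd hfirst (show (-1 : ℤˣ) ≠ 1 by decide)
  · exact absurd hν (by decide)

end FixedWords

end AdjoinFree

theorem isRotated_of_append_eq_append {α : Type*} {l l' m : List α} (hl' : l' ≠ [])
    (h : m ++ l = l' ++ m) : l ~r l' := by
  induction hm : m.length using Nat.strong_induction_on generalizing m with
  | _ n ih =>
    rcases List.append_eq_append_iff.1 h with ⟨s, rfl, rfl⟩ | ⟨s, rfl, hs⟩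
    · exact List.isRotated_append
    · have := List.length_pos_iff.2 hl'
      exact ih s.length (by simp at hm; omega) hs.symm rfl

theorem exists_iterate_eq_of_forall_iterate_mem {α : Type*} {f : α → α} {S : Set α} {x : α}
    (hf : Function.Injective f) (hS : S.Finite) (h : ∀ n, f^[n] x ∈ S) :
    ∃ k, 0 < k ∧ f^[k] x = x := by
  obtain ⟨i, -, j, -, hij, heq⟩ :=
    Set.infinite_univ.exists_lt_map_eq_of_mapsTo (f := fun n => f^[n] x) (fun n _ => h n) hS
  exact ⟨j - i, Nat.sub_pos_of_lt hij, Function.iterate_cancel hf heq.symm⟩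

theorem isConj_pow_apply {G : Type*} [Group G] {f : MulAut G} {x : G} (h : IsConj (f x) x)
    (n : ℕ) : IsConj ((f ^ n) x) x := by
  induction n with
  | zero => exact .refl x
  | succ n ih => exact (MonoidHom.map_isConj (f ^ n).toMonoidHom h).trans ih

theorem not_commute_pow_pow {G : Type*} [Group G] {a c : G} {i j : ℕ}
    (htf : IsTorsionFreeGroup G) (hct : IsCommutativeTransitive G) (hac : ¬ Commute a c)
    (hi : 0 < i) (hj : 0 < j) : ¬ Commute (a ^ i) (c ^ j) := by
  have pow_ne_one {g : G} {n : ℕ} (hg : g ≠ 1) (hn : 0 < n) : g ^ n ≠ 1 := fun h =>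
    htf g hg (isOfFinOrder_iff_pow_eq_one.2 ⟨n, hn, h⟩)
  have ha : a ≠ 1 := fun h => hac (h ▸ .one_left c)
  have hc : c ≠ 1 := fun h => hac (h ▸ .one_right a)
  intro h
  have hacj : Commute a (c ^ j) := hct (pow_ne_one ha hi) (.pow_self a i) h
  exact hac (hct (pow_ne_one hc hj) hacj.symm (.pow_self c j))

namespace AdjoinFree

section Conj

variable {G : Type*} [Group G] {ε : ℤˣ} {g : G} {l l' m : List (ℤˣ × G)} {p q : ℤˣ × G}

/-- Cyclic words without cancellation, the normal forms for conjugacy in `G * ⟨e⟩`. -/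
abbrev IsCyclicallyReduced (l : List (ℤˣ × G)) : Prop := Cycle.Chain NoCancel (l : Cycle (ℤˣ × G))

theorem eq_one_and_eq_neg_of_not_noCancel (h : ¬ NoCancel p q) : p.2 = 1 ∧ q.1 = -p.1 := by
  simp only [NoCancel, Classical.not_imp] at h
  exact ⟨h.1, Int.units_ne_iff_eq_neg.1 (Ne.symm h.2)⟩

theorem isCyclicallyReduced_cons_iff : IsCyclicallyReduced (p :: l) ↔ IsReduced (p :: l ++ [p]) :=
  Cycle.chain_coe_cons _ _ _

theorem IsCyclicallyReduced.isRotated (h : IsCyclicallyReduced l) (hr : l ~r l') :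
    IsCyclicallyReduced l' := by
  rwa [IsCyclicallyReduced, ← Cycle.coe_eq_coe.2 hr]

theorem IsCyclicallyReduced.isReduced (h : IsCyclicallyReduced l) : IsReduced l := by
  cases l with
  | nil => exact .nil
  | cons p l => exact (List.isChain_append.1 (isCyclicallyReduced_cons_iff.1 h)).1

theorem isCyclicallyReduced_or_exists_isConj (hl : IsReduced (l ++ [(ε, g)])) :
    IsCyclicallyReduced (l ++ [(ε, g)]) ∨ ∃ (g' : G) (l' : List (ℤˣ × G)),
      l'.length < l.length + 1 ∧ IsReduced l' ∧
        IsConj (wordProd (l ++ [(ε, g)])) (ofBase g' * wordProd l') := by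
  rw [or_iff_not_imp_left]
  intro hcyc
  cases l with
  | nil => simp [NoCancel] at hcyc
  | cons p l =>
    rw [List.cons_append, isCyclicallyReduced_cons_iff, ← List.cons_append, List.append_assoc,
      List.singleton_append, IsReduced, List.isChain_append_cons_cons] at hcyc
    obtain ⟨rfl, hp⟩ := eq_one_and_eq_neg_of_not_noCancel fun h =>
      hcyc ⟨hl, h, .singleton _⟩
    refine ⟨p.2, l, by simp, (List.isChain_append.1 hl).1.tail, isConj_iff.2 ⟨e ^ (ε : ℤ), ?_⟩⟩
    simp [hp, mul_assoc]

theorem exists_isConj_of_isReduced (g : G) (hl : IsReduced l) :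
    (∃ g' : G, IsConj (ofBase g * wordProd l) (ofBase g')) ∨
      ∃ l' : List (ℤˣ × G), l' ≠ [] ∧ IsCyclicallyReduced l' ∧
        IsConj (ofBase g * wordProd l) (wordProd l') := by
  induction hn : l.length using Nat.strong_induction_on generalizing l g with
  | _ n ih =>
    rcases List.eq_nil_or_concat' l with rfl | ⟨l, ⟨ε, h⟩, rfl⟩
    · exact .inl ⟨g, by rw [wordProd_nil, mul_one]⟩
    have hconj : IsConj (ofBase g * wordProd (l ++ [(ε, h)])) (wordProd (l ++ [(ε, h * g)])) :=
      isConj_iff.2 ⟨(ofBase g)⁻¹, by simp [mul_assoc]⟩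
    rcases isCyclicallyReduced_or_exists_isConj ((isReduced_concat_iff (h * g)).1 hl) with
      hcyc | ⟨g₁, l₁, hlt, hl₁, hconj₁⟩
    · exact .inr ⟨_, by simp, hcyc, hconj⟩
    · rcases ih l₁.length (by simp at hn; omega) g₁ hl₁ rfl with
        ⟨g', hg'⟩ | ⟨l', hne, hcyc, hl'⟩
      · exact .inl ⟨g', (hconj.trans hconj₁).trans hg'⟩
      · exact .inr ⟨l', hne, hcyc, (hconj.trans hconj₁).trans hl'⟩

theorem exists_isConj_ofBase_or_isCyclicallyReduced (x : AdjoinFree G) :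
    (∃ g : G, IsConj x (ofBase g)) ∨
      ∃ l : List (ℤˣ × G), l ≠ [] ∧ IsCyclicallyReduced l ∧ IsConj x (wordProd l) := by
  obtain ⟨g, l, hl, rfl⟩ := exists_eq_ofBase_mul_wordProd x
  exact exists_isConj_of_isReduced g hl

/-- A conjugator that cancels against a cyclically reduced word can be shortened at the price of
rotating that word. -/
theorem exists_shorter_conjugator {y : AdjoinFree G} (hm : IsReduced m)
    (hl : IsCyclicallyReduced l) (hml : ¬ IsReduced (m ++ l))
    (h : ofBase g * wordProd m * wordProd l = y * (ofBase g * wordProd m)) :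
    ∃ (g₁ : G) (m₁ l₁ : List (ℤˣ × G)), IsReduced m₁ ∧ m₁.length < m.length ∧ l ~r l₁ ∧
      ofBase g₁ * wordProd m₁ * wordProd l₁ = y * (ofBase g₁ * wordProd m₁) := by
  rcases List.eq_nil_or_concat' m with rfl | ⟨m, ⟨ε, k⟩, rfl⟩
  · exact absurd hl.isReduced hml
  rcases l with - | ⟨p, l⟩
  · exact absurd (by simpa using hm) hml
  rw [List.append_assoc, List.singleton_append, IsReduced, List.isChain_append_cons_cons] at hml
  obtain ⟨rfl, hp⟩ := eq_one_and_eq_neg_of_not_noCancel fun h => hml ⟨hm, h, hl.isReduced⟩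
  obtain ⟨g₁, m₁, hm₁, hlen, heq⟩ := exists_mul_ofBase_eq g p.2 (List.isChain_append.1 hm).1
  refine ⟨g₁, m₁, l ++ [p], hm₁, by simp [hlen], ⟨1, by simp⟩, ?_⟩
  have hshort : ofBase g * wordProd m * ofBase p.2 * wordProd l =
      y * (ofBase g * wordProd m * e ^ (ε : ℤ)) := by
    simpa [hp, mul_assoc] using h
  rw [← heq, wordProd_append, ← mul_assoc, hshort]
  simp [hp, mul_assoc]

theorem exists_isReduced_append_of_isConj {y : AdjoinFree G} (hl : IsCyclicallyReduced l)
    (h : IsConj (wordProd l) y) :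
    ∃ (g : G) (m l₁ : List (ℤˣ × G)), l ~r l₁ ∧ IsReduced (m ++ l₁) ∧
      ofBase g * wordProd m * wordProd l₁ = y * (ofBase g * wordProd m) := by
  obtain ⟨z, hz⟩ := isConj_iff.1 h
  obtain ⟨g, m, hm, rfl⟩ := exists_eq_ofBase_mul_wordProd z
  rw [mul_inv_eq_iff_eq_mul] at hz
  clear h
  induction hn : m.length using Nat.strong_induction_on generalizing g m l with
  | _ n ih =>
    by_cases hml : IsReduced (m ++ l)
    · exact ⟨g, m, l, .refl l, hml, hz⟩
    · obtain ⟨g₁, m₁, l₁, hm₁, hlt, hr, hz₁⟩ := exists_shorter_conjugator hm hl hml hz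
      obtain ⟨g₂, m₂, l₂, hr₂, hred, hz₂⟩ :=
        ih m₁.length (hn ▸ hlt) (hl.isRotated hr) g₁ m₁ hm₁ hz₁ rfl
      exact ⟨g₂, m₂, l₂, hr.trans hr₂, hred, hz₂⟩

theorem IsCyclicallyReduced.not_isConj_ofBase (hl : IsCyclicallyReduced l) (hne : l ≠ []) (g : G) :
    ¬ IsConj (wordProd l) (ofBase g) := by
  intro h
  obtain ⟨g₁, m, l₁, hr, hred, heq⟩ := exists_isReduced_append_of_isConj hl h
  have hword : ofBase g₁ * wordProd (m ++ l₁) = ofBase (g * g₁) * wordProd m := by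
    simpa [mul_assoc] using heq
  obtain rfl : l₁ = [] := List.append_right_eq_self.1
    (hred.ofBase_mul_wordProd_inj (List.isChain_append.1 hred).1 hword).2
  exact hne (List.isRotated_nil_iff.1 hr)

theorem isRotated_concat_of_mul_eq_mul {k : G} (hml : IsReduced (m ++ l))
    (hlm : IsReduced (l' ++ [(ε, k * g)] ++ m))
    (h : ofBase g * wordProd m * wordProd l =
      wordProd (l' ++ [(ε, k)]) * (ofBase g * wordProd m)) : l ~r l' ++ [(ε, k)] := by
  have hword : ofBase g * wordProd (m ++ l) =
      ofBase 1 * wordProd (l' ++ [(ε, k * g)] ++ m) := by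
    simpa [mul_assoc] using h
  obtain ⟨rfl, happend⟩ := hml.ofBase_mul_wordProd_inj hlm hword
  rw [mul_one] at happend
  exact isRotated_of_append_eq_append (by simp) happend

theorem isRotated_of_mul_eq_mul (hl' : IsCyclicallyReduced l') (hne : l' ≠ [])
    (hml : IsReduced (m ++ l))
    (h : ofBase g * wordProd m * wordProd l = wordProd l' * (ofBase g * wordProd m)) :
    l ~r l' := by
  induction m generalizing g l' with
  | nil =>
    obtain ⟨l', ⟨ε, k⟩, rfl⟩ := (List.eq_nil_or_concat' l').resolve_left hne
    exact isRotated_concat_of_mul_eq_mul hml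
      (by simpa using (isReduced_concat_iff (k * g)).1 hl'.isReduced) h
  | cons p m ih =>
    obtain ⟨l', ⟨ε, k⟩, rfl⟩ := (List.eq_nil_or_concat' l').resolve_left hne
    by_cases hlm : IsReduced (l' ++ [(ε, k * g)] ++ p :: m)
    · exact isRotated_concat_of_mul_eq_mul hml hlm h
    rw [List.append_assoc, List.singleton_append, IsReduced, List.isChain_append_cons_cons] at hlm
    obtain ⟨hkg, hp⟩ := eq_one_and_eq_neg_of_not_noCancel fun hcancel =>
      hlm ⟨(isReduced_concat_iff _).1 hl'.isReduced, hcancel, (List.isChain_append.1 hml).1⟩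
    obtain rfl : g = k⁻¹ := (inv_eq_of_mul_eq_one_right hkg).symm
    have hr : (ε, k) :: l' ~r l' ++ [(ε, k)] := ⟨1, by simp⟩
    refine (ih (g := p.2) (hl'.isRotated hr.symm) (by simp) hml.tail ?_).trans hr
    have hshort : (ofBase k)⁻¹ * ((e ^ (ε : ℤ))⁻¹ * (ofBase p.2 * wordProd m * wordProd l)) =
        wordProd l' * (ofBase p.2 * wordProd m) := by
      simpa [hp, mul_assoc] using h
    rw [inv_mul_eq_iff_eq_mul, inv_mul_eq_iff_eq_mul] at hshort
    simp only [hshort, wordProd_cons, mul_assoc]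

theorem isRotated_of_isConj (hl : IsCyclicallyReduced l) (hl' : IsCyclicallyReduced l')
    (hne : l' ≠ []) (h : IsConj (wordProd l) (wordProd l')) : l ~r l' := by
  obtain ⟨g, m, l₁, hr, hred, heq⟩ := exists_isReduced_append_of_isConj hl h
  exact hr.trans (isRotated_of_mul_eq_mul hl' hne hred heq)

end Conj

section Shift

variable {G : Type*} [Group G] {p : ℤˣ × G} {l : List (ℤˣ × G)}

theorem IsCyclicallyReduced.shiftWord (h : IsCyclicallyReduced (p :: l)) (s : G) :
    IsCyclicallyReduced (shiftWord s p.1 (p :: l)) := by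
  have hred := (isCyclicallyReduced_cons_iff.1 h).shiftWord s p.1
  rw [shiftWord_concat] at hred
  exact isCyclicallyReduced_cons_iff.2 ((isReduced_concat_iff _).1 hred)

theorem isConj_shift_wordProd (s : G) (p : ℤˣ × G) (l : List (ℤˣ × G)) :
    IsConj (shift s (wordProd (p :: l))) (wordProd (shiftWord s p.1 (p :: l))) := by
  refine isConj_iff.2 ⟨(ofBase (leftTwist s p.1))⁻¹, ?_⟩
  rw [inv_inv, mul_assoc, shift_wordProd_mul_leftTwist, nextSign, inv_mul_cancel_left]

theorem exists_shiftWord_pow_eq_self {s : G} (hl : IsCyclicallyReduced (p :: l))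
    (h : IsConj (shift s (wordProd (p :: l))) (wordProd (p :: l))) :
    ∃ k, 0 < k ∧ shiftWord (s ^ k) p.1 (p :: l) = p :: l := by
  have hrot (n : ℕ) : shiftWord (s ^ n) p.1 (p :: l) ~r p :: l := by
    refine isRotated_of_isConj (hl.shiftWord _) hl (by simp) ?_
    refine (isConj_shift_wordProd _ _ _).symm.trans ?_
    rw [shift_pow]
    exact isConj_pow_apply h n
  have hfin : {w | w ~r p :: l}.Finite :=
    (List.finite_toSet (p :: l).cyclicPermutations).subset fun w hw =>
      List.mem_cyclicPermutations_iff.2 hw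
  simp only [shiftWord_pow] at hrot ⊢
  exact exists_iterate_eq_of_forall_iterate_mem (shiftWord_injective s p.1) hfin hrot

theorem exists_isConj_ofBase_of_isConj_shift {a c : G} (htf : IsTorsionFreeGroup G)
    (hct : IsCommutativeTransitive G) (hac : ¬ Commute a c) {x : AdjoinFree G}
    (ha : IsConj (shift a x) x) (hc : IsConj (shift c x) x) : ∃ g : G, IsConj x (ofBase g) := by
  refine (exists_isConj_ofBase_or_isCyclicallyReduced x).resolve_right ?_
  rintro ⟨l, hne, hl, hx⟩
  obtain ⟨p, l, rfl⟩ := List.exists_cons_of_ne_nil hne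
  have hfix {s : G} (hs : IsConj (shift s x) x) :
      IsConj (shift s (wordProd (p :: l))) (wordProd (p :: l)) :=
    ((MonoidHom.map_isConj (shift s).toMonoidHom hx).symm.trans hs).trans hx
  obtain ⟨i, hi, hai⟩ := exists_shiftWord_pow_eq_self hl (hfix ha)
  obtain ⟨j, hj, hcj⟩ := exists_shiftWord_pow_eq_self hl (hfix hc)
  obtain h | ⟨hp, q, hq, hneg⟩ := eq_nil_or_eq_singleton_of_shiftWord_eq_self hct
    (not_commute_pow_pow htf hct hac hi hj) (isCyclicallyReduced_cons_iff.1 hl) hai hcj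
  · exact absurd h hne
  · obtain ⟨rfl, -⟩ := List.cons.inj hq
    exact absurd (hp.symm.trans hneg) (by decide)

end Shift

end AdjoinFree

section CosetRelations

variable {G : Type*} [Group G] {m n : ℕ}

theorem eq_or_rel_of_quot_mk_eq {α : Type*} {r : α → α → Prop} (hsymm : ∀ x y, r x y → r y x)
    (htrans : ∀ x y z, r x y → r y z → r x z) {x y : α} (h : Quot.mk r x = Quot.mk r y) :
    x = y ∨ r x y := by
  induction Quot.eqvGen_exact h with
  | rel x y hxy => exact .inr hxy
  | refl x => exact .inl rfl
  | symm x y hxy ih => exact (ih (Quot.eqvGen_sound hxy)).imp Eq.symm (hsymm _ _)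
  | trans x y z hxy hyz ihxy ihyz =>
    rcases ihxy (Quot.eqvGen_sound hxy) with rfl | hxy
    · exact ihyz (Quot.eqvGen_sound hyz)
    · rcases ihyz (Quot.eqvGen_sound hyz) with rfl | hyz
      · exact .inr hxy
      · exact .inr (htrans _ _ _ hxy hyz)

theorem DoubleCosetRel.symm {x y : G × G × G} (h : DoubleCosetRel G m n x y) :
    DoubleCosetRel G m n y x := by
  rcases h with ⟨hx, hy⟩ | ⟨hx₁, hx₂, hy₁, hy₂, a, c, hxa, hya, hxc, hyc, γ, hγ, ε, hε, h⟩
  · exact .inl ⟨hy, hx⟩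
  · exact .inr ⟨hy₁, hy₂, hx₁, hx₂, a, c, hya, hxa, hyc, hxc, γ⁻¹, inv_mem hγ, ε⁻¹, inv_mem hε,
      by simp [← h, mul_assoc]⟩

theorem DoubleCosetRel.trans {x y z : G × G × G} (hxy : DoubleCosetRel G m n x y)
    (hyz : DoubleCosetRel G m n y z) : DoubleCosetRel G m n x z := by
  rcases hxy with ⟨hx, hy⟩ | ⟨hx₁, hx₂, hy₁, hy₂, a, c, hxa, hya, hxc, hyc, γ, hγ, ε, hε, hxy⟩
  · rcases hyz with ⟨-, hz⟩ | ⟨hy₁, hy₂, -⟩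
    · exact .inl ⟨hx, hz⟩
    · exact absurd hy (not_or.2 ⟨hy₁, hy₂⟩)
  · rcases hyz with ⟨hy, -⟩ | ⟨-, -, hz₁, hz₂, a', c', hya', hza, hyc', hzc, γ', hγ', ε', hε', hyz⟩
    · exact absurd hy (not_or.2 ⟨hy₁, hy₂⟩)
    rw [zpowers_pow_eq m (hya'.symm.trans hya)] at hγ'
    rw [zpowers_pow_eq n (hyc'.symm.trans hyc)] at hε'
    exact .inr ⟨hx₁, hx₂, hz₁, hz₂, a, c, hxa, hza.trans (hya'.symm.trans hya), hxc,
      hzc.trans (hyc'.symm.trans hyc), γ' * γ, mul_mem hγ' hγ, ε * ε', mul_mem hε hε',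
      by simp only [← hyz, ← hxy, mul_assoc]⟩

theorem LeftCosetRel.doubleCosetRel {x y : G × G} (h : LeftCosetRel G m x y) :
    DoubleCosetRel G 0 m (x.2, x.1, x.2) (y.2, y.1, y.2) := by
  rcases h with ⟨hx, hy⟩ | ⟨hx, hy, b, hxb, hyb, h⟩
  · exact .inl ⟨.inl hx, .inl hy⟩
  · exact .inr ⟨hx, hx, hy, hy, b, b, hxb, hyb, hxb, hyb, 1, one_mem _, _, h, by simp⟩

theorem RightCosetRel.doubleCosetRel {x y : G × G} (h : RightCosetRel G m x y) :
    DoubleCosetRel G m 0 (x.2, x.1, x.2) (y.2, y.1, y.2) := by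
  rcases h with ⟨hx, hy⟩ | ⟨hx, hy, b, hxb, hyb, h⟩
  · exact .inl ⟨.inl hx, .inl hy⟩
  · exact .inr ⟨hx, hx, hy, hy, b, b, hxb, hyb, hxb, hyb, _, inv_mem h, 1, one_mem _, by simp⟩

/-- The elements `p` and `q` are equal or have the same cyclic centralizer: the information on
their centralized entries that is shared by the tuples in a coset class. -/
def EqOrSameCyclicCentralizer (p q : G) : Prop :=
  p = q ∨ ∃ b, elemCentralizer p = Subgroup.zpowers b ∧ elemCentralizer q = Subgroup.zpowers b

theorem EqOrSameCyclicCentralizer.elemCentralizer_eq {p q : G}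
    (h : EqOrSameCyclicCentralizer p q) : elemCentralizer p = elemCentralizer q := by
  rcases h with rfl | ⟨b, hp, hq⟩
  · rfl
  · exact hp.trans hq.symm

theorem zpowers_pow_le (b : G) (m : ℕ) : Subgroup.zpowers (b ^ m) ≤ Subgroup.zpowers b :=
  Subgroup.zpowers_le_of_mem (Subgroup.npow_mem_zpowers b m)

theorem exists_mul_mul_eq_of_doubleCoset_eq {p q r p' q' r' : G} (hp : p ≠ 1) (hr : r ≠ 1)
    (h : Quot.mk (DoubleCosetRel G m n) (p, q, r) = Quot.mk _ (p', q', r')) :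
    EqOrSameCyclicCentralizer p p' ∧ EqOrSameCyclicCentralizer r r' ∧
      ∃ γ ∈ elemCentralizer p, ∃ ε ∈ elemCentralizer r, γ * q * ε = q' := by
  rcases eq_or_rel_of_quot_mk_eq (fun _ _ => .symm) (fun _ _ _ => .trans) h with heq | hrel
  · obtain ⟨rfl, rfl, rfl⟩ : p = p' ∧ q = q' ∧ r = r' := by simpa using heq
    exact ⟨.inl rfl, .inl rfl, 1, one_mem _, 1, one_mem _, by simp⟩
  · rcases hrel with ⟨hpr, -⟩ | ⟨-, -, -, -, b, d, hb, hb', hd, hd', γ, hγ, ε, hε, heq⟩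
    · exact absurd hpr (not_or.2 ⟨hp, hr⟩)
    · exact ⟨.inr ⟨b, hb, hb'⟩, .inr ⟨d, hd, hd'⟩, γ, hb ▸ zpowers_pow_le b m hγ, ε,
        hd ▸ zpowers_pow_le d n hε, heq⟩

theorem doubleCoset_eq_of_leftCoset_eq {p q p' q' : G}
    (h : Quot.mk (LeftCosetRel G m) (p, q) = Quot.mk _ (p', q')) :
    Quot.mk (DoubleCosetRel G 0 m) (q, p, q) = Quot.mk _ (q', p', q') :=
  congrArg (Quot.map (fun x : G × G => (x.2, x.1, x.2)) fun _ _ => LeftCosetRel.doubleCosetRel) h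

theorem doubleCoset_eq_of_rightCoset_eq {p q p' q' : G}
    (h : Quot.mk (RightCosetRel G m) (p, q) = Quot.mk _ (p', q')) :
    Quot.mk (DoubleCosetRel G m 0) (q, p, q) = Quot.mk _ (q', p', q') :=
  congrArg (Quot.map (fun x : G × G => (x.2, x.1, x.2)) fun _ _ => RightCosetRel.doubleCosetRel) h

theorem finite_setOf_zpowers_eq (b : G) :
    {z : G | Subgroup.zpowers z = Subgroup.zpowers b}.Finite := by
  by_cases hb : IsOfFinOrder b
  · exact hb.finite_zpowers.subset fun z hz => hz ▸ Subgroup.mem_zpowers z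
  · refine (Set.toFinite {b, b⁻¹}).subset fun z hz => ?_
    simpa [eq_comm, inv_eq_iff_eq_inv] using (Subgroup.zpowers_eq_zpowers_iff hb).1 hz.symm

theorem exists_pow_apply_eq_of_zpowers_apply_eq {f : MulAut G} {b : G}
    (h : Subgroup.zpowers (f b) = Subgroup.zpowers b) : ∃ k, 0 < k ∧ (f ^ k) b = b := by
  have hpow (n : ℕ) : Subgroup.zpowers (f^[n] b) = Subgroup.zpowers b := by
    induction n with
    | zero => rfl
    | succ n ih =>
      rw [Function.iterate_succ_apply', ← h]
      simpa using congrArg (Subgroup.map (f : G →* G)) ih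
  obtain ⟨k, hk, heq⟩ :=
    exists_iterate_eq_of_forall_iterate_mem f.injective (finite_setOf_zpowers_eq b) hpow
  exact ⟨k, hk, (congrFun (smul_iterate f k) b).symm.trans heq⟩

end CosetRelations

namespace AdjoinFree

section Fixed

variable {G : Type*} [Group G] {a c : G} {m n : ℕ}

theorem mem_range_ofBase_of_shift_eq (hct : IsCommutativeTransitive G) (hac : ¬ Commute a c)
    {x : AdjoinFree G} (ha : shift a x = x) (hc : shift c x = x) :
    x ∈ (ofBase : G →* AdjoinFree G).range :=
  mem_range_ofBase_of_shift_eq_mul hct hac (.one_left 1) (.one_left 1) (by simpa using ha)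
    (by simpa using hc)

theorem mem_range_ofBase_of_zpowers_shift_eq (htf : IsTorsionFreeGroup G)
    (hct : IsCommutativeTransitive G) (hac : ¬ Commute a c) {b : AdjoinFree G}
    (ha : Subgroup.zpowers (shift a b) = Subgroup.zpowers b)
    (hc : Subgroup.zpowers (shift c b) = Subgroup.zpowers b) :
    b ∈ (ofBase : G →* AdjoinFree G).range := by
  obtain ⟨i, hi, hai⟩ := exists_pow_apply_eq_of_zpowers_apply_eq ha
  obtain ⟨j, hj, hcj⟩ := exists_pow_apply_eq_of_zpowers_apply_eq hc
  rw [← shift_pow] at hai hcj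
  exact mem_range_ofBase_of_shift_eq hct (not_commute_pow_pow htf hct hac hi hj) hai hcj

theorem mem_range_ofBase_of_eqOrSameCyclicCentralizer (htf : IsTorsionFreeGroup G)
    (hct : IsCommutativeTransitive G) (hac : ¬ Commute a c) {x : AdjoinFree G}
    (ha : EqOrSameCyclicCentralizer x (shift a x))
    (hc : EqOrSameCyclicCentralizer x (shift c x)) : x ∈ (ofBase : G →* AdjoinFree G).range := by
  by_cases hcyc : ∃ b, elemCentralizer x = Subgroup.zpowers b
  · obtain ⟨b, hb⟩ := hcyc
    have hzpowers {s : G} (hs : EqOrSameCyclicCentralizer x (shift s x)) :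
        Subgroup.zpowers (shift s b) = Subgroup.zpowers b := by
      rw [← elemCentralizer_map (shift s) hb, ← hs.elemCentralizer_eq, hb]
    have hbG := mem_range_ofBase_of_zpowers_shift_eq htf hct hac (hzpowers ha) (hzpowers hc)
    have hxb : x ∈ Subgroup.zpowers b :=
      hb ▸ Subgroup.mem_centralizer_singleton_iff.2 rfl
    exact Subgroup.zpowers_le_of_mem hbG hxb
  · have hfix {y : AdjoinFree G} (hy : EqOrSameCyclicCentralizer x y) : y = x :=
      (hy.resolve_right fun ⟨b, hb, _⟩ => hcyc ⟨b, hb⟩).symm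
    exact mem_range_ofBase_of_shift_eq hct hac (hfix ha) (hfix hc)

theorem exists_commute_of_mem_elemCentralizer_ofBase {g : G} {z : AdjoinFree G} (hg : g ≠ 1)
    (hz : z ∈ elemCentralizer (ofBase g)) : ∃ u, Commute g u ∧ ofBase u = z := by
  have hz : Commute (ofBase g) z := (Subgroup.mem_centralizer_singleton_iff.1 hz).symm
  obtain ⟨u, rfl⟩ := mem_range_ofBase_of_commute hg hz
  exact ⟨u, hz.of_map ofBase_injective, rfl⟩

theorem mem_range_ofBase_of_doubleCoset_shift_eq (htf : IsTorsionFreeGroup G)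
    (hct : IsCommutativeTransitive G) (hac : ¬ Commute a c) {p q r : AdjoinFree G} (hp : p ≠ 1)
    (hr : r ≠ 1)
    (ha : Quot.mk (DoubleCosetRel _ m n) (shift a p, shift a q, shift a r) = Quot.mk _ (p, q, r))
    (hc : Quot.mk (DoubleCosetRel _ m n) (shift c p, shift c q, shift c r) = Quot.mk _ (p, q, r)) :
    p ∈ (ofBase : G →* AdjoinFree G).range ∧ q ∈ (ofBase : G →* AdjoinFree G).range ∧
      r ∈ (ofBase : G →* AdjoinFree G).range := by
  obtain ⟨hpa, hra, γ, hγ, ε, hε, hqa⟩ := exists_mul_mul_eq_of_doubleCoset_eq hp hr ha.symm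
  obtain ⟨hpc, hrc, γ', hγ', ε', hε', hqc⟩ := exists_mul_mul_eq_of_doubleCoset_eq hp hr hc.symm
  have hpG := mem_range_ofBase_of_eqOrSameCyclicCentralizer htf hct hac hpa hpc
  have hrG := mem_range_ofBase_of_eqOrSameCyclicCentralizer htf hct hac hra hrc
  refine ⟨hpG, ?_, hrG⟩
  obtain ⟨p, rfl⟩ := hpG
  obtain ⟨r, rfl⟩ := hrG
  have hp : p ≠ 1 := fun h => hp (by rw [h, map_one])
  have hr : r ≠ 1 := fun h => hr (by rw [h, map_one])
  obtain ⟨u, hu, rfl⟩ := exists_commute_of_mem_elemCentralizer_ofBase hp hγ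
  obtain ⟨u', hu', rfl⟩ := exists_commute_of_mem_elemCentralizer_ofBase hp hγ'
  obtain ⟨v, hv, rfl⟩ := exists_commute_of_mem_elemCentralizer_ofBase hr hε
  obtain ⟨v', hv', rfl⟩ := exists_commute_of_mem_elemCentralizer_ofBase hr hε'
  exact mem_range_ofBase_of_shift_eq_mul hct hac (hct hp hu hu') (hct hr hv hv') hqa.symm
    hqc.symm

theorem comesFrom_ofBase_leftCoset_of_smul_eq (htf : IsTorsionFreeGroup G)
    (hct : IsCommutativeTransitive G) (hac : ¬ Commute a c)
    {β : Quot (LeftCosetRel (AdjoinFree G) m)}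
    (ha : shift a • WE.leftCoset m β = WE.leftCoset m β)
    (hc : shift c • WE.leftCoset m β = WE.leftCoset m β) :
    (WE.leftCoset m β).ComesFrom ofBase := by
  obtain ⟨p, q⟩ := β
  by_cases hq : q = 1
  · have htriv : Quot.mk (LeftCosetRel (AdjoinFree G) m) (p, q) = Quot.mk _ (ofBase 1, ofBase 1) :=
      Quot.sound (.inl ⟨hq, map_one _⟩)
    exact htriv ▸ .leftCoset m 1 1
  · have hfix {s : G} (hs : shift s • WE.leftCoset m (Quot.mk _ (p, q)) =
        WE.leftCoset m (Quot.mk _ (p, q))) :=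
      doubleCoset_eq_of_leftCoset_eq (eq_of_heq (WE.leftCoset.inj hs).2)
    obtain ⟨⟨q, rfl⟩, ⟨p, rfl⟩, -⟩ :=
      mem_range_ofBase_of_doubleCoset_shift_eq htf hct hac hq hq (hfix ha) (hfix hc)
    exact .leftCoset m p q

theorem comesFrom_ofBase_rightCoset_of_smul_eq (htf : IsTorsionFreeGroup G)
    (hct : IsCommutativeTransitive G) (hac : ¬ Commute a c)
    {β : Quot (RightCosetRel (AdjoinFree G) m)}
    (ha : shift a • WE.rightCoset m β = WE.rightCoset m β)
    (hc : shift c • WE.rightCoset m β = WE.rightCoset m β) :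
    (WE.rightCoset m β).ComesFrom ofBase := by
  obtain ⟨p, q⟩ := β
  by_cases hq : q = 1
  · have htriv : Quot.mk (RightCosetRel (AdjoinFree G) m) (p, q) = Quot.mk _ (ofBase 1, ofBase 1) :=
      Quot.sound (.inl ⟨hq, map_one _⟩)
    exact htriv ▸ .rightCoset m 1 1
  · have hfix {s : G} (hs : shift s • WE.rightCoset m (Quot.mk _ (p, q)) =
        WE.rightCoset m (Quot.mk _ (p, q))) :=
      doubleCoset_eq_of_rightCoset_eq (eq_of_heq (WE.rightCoset.inj hs).2)
    obtain ⟨⟨q, rfl⟩, ⟨p, rfl⟩, -⟩ :=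
      mem_range_ofBase_of_doubleCoset_shift_eq htf hct hac hq hq (hfix ha) (hfix hc)
    exact .rightCoset m p q

theorem comesFrom_ofBase_doubleCoset_of_smul_eq (htf : IsTorsionFreeGroup G)
    (hct : IsCommutativeTransitive G) (hac : ¬ Commute a c)
    {β : Quot (DoubleCosetRel (AdjoinFree G) m n)}
    (ha : shift a • WE.doubleCoset m n β = WE.doubleCoset m n β)
    (hc : shift c • WE.doubleCoset m n β = WE.doubleCoset m n β) :
    (WE.doubleCoset m n β).ComesFrom ofBase := by
  obtain ⟨p, q, r⟩ := β
  by_cases hpr : p = 1 ∨ r = 1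
  · have htriv : Quot.mk (DoubleCosetRel (AdjoinFree G) m n) (p, q, r) =
        Quot.mk _ (ofBase 1, ofBase 1, ofBase 1) :=
      Quot.sound (.inl ⟨hpr, .inl (map_one _)⟩)
    exact htriv ▸ .doubleCoset m n 1 1 1
  · obtain ⟨hp, hr⟩ := not_or.1 hpr
    obtain ⟨⟨p, rfl⟩, ⟨q, rfl⟩, r, rfl⟩ := mem_range_ofBase_of_doubleCoset_shift_eq htf hct hac
      hp hr (eq_of_heq (WE.doubleCoset.inj ha).2.2) (eq_of_heq (WE.doubleCoset.inj hc).2.2)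
    exact .doubleCoset m n p q r

theorem comesFrom_ofBase_of_smul_eq (htf : IsTorsionFreeGroup G)
    (hct : IsCommutativeTransitive G) (hac : ¬ Commute a c) {β : WE (AdjoinFree G)}
    (ha : shift a • β = β) (hc : shift c • β = β) : β.ComesFrom ofBase := by
  rcases β with x | ⟨⟨x⟩⟩ | ⟨m, β⟩ | ⟨m, β⟩ | ⟨m, n, β⟩
  · obtain ⟨g, rfl⟩ := mem_range_ofBase_of_shift_eq hct hac (WE.home.inj ha) (WE.home.inj hc)
    exact .home g
  · obtain ⟨g, hg⟩ := exists_isConj_ofBase_of_isConj_shift htf hct hac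
      (ConjClasses.mk_eq_mk_iff_isConj.1 (WE.conj.inj ha))
      (ConjClasses.mk_eq_mk_iff_isConj.1 (WE.conj.inj hc))
    change (WE.conj (ConjClasses.mk x)).ComesFrom ofBase
    rw [ConjClasses.mk_eq_mk_iff_isConj.2 hg]
    exact .conj g
  · exact comesFrom_ofBase_leftCoset_of_smul_eq htf hct hac ha hc
  · exact comesFrom_ofBase_rightCoset_of_smul_eq htf hct hac ha hc
  · exact comesFrom_ofBase_doubleCoset_of_smul_eq htf hct hac ha hc

theorem infinite_orbit_closure_shift (htf : IsTorsionFreeGroup G)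
    (hct : IsCommutativeTransitive G) (hac : ¬ Commute a c) {β : WE (AdjoinFree G)}
    (hβ : ¬ β.ComesFrom ofBase) :
    (MulAction.orbit (Subgroup.closure {shift a, shift c}) β).Infinite := by
  intro hfin
  have exists_pow_fix {s : G} (hs : shift s ∈ Subgroup.closure {shift a, shift c}) :
      ∃ k, 0 < k ∧ shift (s ^ k) • β = β := by
    have hindex : (MulAction.stabilizer (Subgroup.closure {shift a, shift c}) β).index ≠ 0 := by
      rw [MulAction.index_stabilizer]
      exact Set.ncard_ne_zero_of_mem (MulAction.mem_orbit_self β) hfin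
    obtain ⟨k, hk, -, hmem⟩ := Subgroup.exists_pow_mem_of_index_ne_zero hindex ⟨shift s, hs⟩
    exact ⟨k, hk, shift_pow s k ▸ hmem⟩
  obtain ⟨i, hi, hai⟩ := exists_pow_fix (s := a) (Subgroup.subset_closure (by simp))
  obtain ⟨j, hj, hcj⟩ := exists_pow_fix (s := c) (Subgroup.subset_closure (by simp))
  exact hβ (comesFrom_ofBase_of_smul_eq htf hct (not_commute_pow_pow htf hct hac hi hj) hai hcj)

end Fixed

end AdjoinFree

section AlternatingProducts

variable {G : Type*} [Group G] {A B : Subgroup G}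

/-- The product `b₁ * a₁ * ⋯ * bₖ * aₖ` of a list of pairs `(bᵢ, aᵢ)`, for writing elements of a
free product `A * B`. Trivial factors are allowed. -/
def alternatingProd (l : List (B × A)) : G :=
  (l.map fun p => (p.1 : G) * p.2).prod

@[simp]
theorem alternatingProd_nil : alternatingProd ([] : List (B × A)) = 1 := rfl

@[simp]
theorem alternatingProd_cons (p : B × A) (l : List (B × A)) :
    alternatingProd (p :: l) = p.1 * p.2 * alternatingProd l :=
  List.prod_cons

@[simp]
theorem alternatingProd_append (l l' : List (B × A)) :
    alternatingProd (l ++ l') = alternatingProd l * alternatingProd l' := by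
  simp [alternatingProd]

theorem exists_alternatingProd_eq
    (h : Function.Surjective (Monoid.Coprod.lift A.subtype B.subtype)) (x : G) :
    ∃ l : List (B × A), alternatingProd l = x := by
  obtain ⟨z, rfl⟩ := h x
  induction z using Monoid.Coprod.induction_on with
  | inl a => exact ⟨[(1, a)], by simp⟩
  | inr b => exact ⟨[(b, 1)], by simp⟩
  | mul y z hy hz =>
    obtain ⟨l, hl⟩ := hy
    obtain ⟨l', hl'⟩ := hz
    exact ⟨l ++ l', by rw [map_mul, ← hl, ← hl', alternatingProd_append]⟩

theorem isConj_alternatingProd_append_comm (l l' : List (B × A)) :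
    IsConj (alternatingProd (l ++ l')) (alternatingProd (l' ++ l)) :=
  isConj_iff.2 ⟨(alternatingProd l)⁻¹, by simp⟩

theorem exists_isConj_alternatingProd_cons {p : B × A} (hp : p.1 = 1 ∨ p.2 = 1)
    (l : List (B × A)) :
    (∃ x : G, (x ∈ A ∨ x ∈ B) ∧ IsConj (alternatingProd (p :: l)) x) ∨
      ∃ l' : List (B × A), l'.length = l.length ∧
        IsConj (alternatingProd (p :: l)) (alternatingProd l') := by
  obtain ⟨b, a⟩ := p
  rcases hp with rfl | rfl
  · rcases List.eq_nil_or_concat' l with rfl | ⟨l, q, rfl⟩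
    · have heq : alternatingProd [((1 : B), a)] = a := by simp
      exact .inl ⟨a, .inl a.2, heq ▸ .refl _⟩
    · exact .inr ⟨l ++ [(q.1, q.2 * a)], by simp, isConj_iff.2 ⟨(a : G)⁻¹, by simp [mul_assoc]⟩⟩
  · rcases l with - | ⟨q, l⟩
    · have heq : alternatingProd [(b, (1 : A))] = b := by simp
      exact .inl ⟨b, .inr b.2, heq ▸ .refl _⟩
    · have heq : alternatingProd ((b, (1 : A)) :: q :: l) =
          alternatingProd ((b * q.1, q.2) :: l) := by
        simp [mul_assoc]
      exact .inr ⟨(b * q.1, q.2) :: l, rfl, heq ▸ .refl _⟩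

theorem exists_isConj_of_alternatingProd (l : List (B × A)) :
    (∃ x : G, (x ∈ A ∨ x ∈ B) ∧ IsConj (alternatingProd l) x) ∨
      ∃ l' : List (B × A), l' ≠ [] ∧ (∀ p ∈ l', p.1 ≠ 1 ∧ p.2 ≠ 1) ∧
        IsConj (alternatingProd l) (alternatingProd l') := by
  induction hn : l.length using Nat.strong_induction_on generalizing l with
  | _ n ih =>
    rcases eq_or_ne l [] with rfl | hne
    · exact .inl ⟨1, .inl A.one_mem, .refl _⟩
    by_cases hl : ∀ p ∈ l, p.1 ≠ 1 ∧ p.2 ≠ 1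
    · exact .inr ⟨l, hne, hl, .refl _⟩
    obtain ⟨p, hpl, hp⟩ : ∃ p ∈ l, p.1 = 1 ∨ p.2 = 1 := by simpa [or_iff_not_imp_left] using hl
    obtain ⟨l₁, l₂, rfl⟩ := List.append_of_mem hpl
    have hrot := isConj_alternatingProd_append_comm l₁ (p :: l₂)
    rcases exists_isConj_alternatingProd_cons hp (l₂ ++ l₁) with
      ⟨x, hx, hconj⟩ | ⟨r, hr, hconj⟩
    · exact .inl ⟨x, hx, hrot.trans hconj⟩
    have hlt : r.length < n := by
      simp only [List.length_append, List.length_cons] at hn hr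
      omega
    exact (ih _ hlt r rfl).imp (fun ⟨x, hx, h⟩ => ⟨x, hx, hrot.trans (hconj.trans h)⟩)
      fun ⟨l', hne', hl', h⟩ => ⟨l', hne', hl', hrot.trans (hconj.trans h)⟩

end AlternatingProducts

section ComesFrom

variable {G H : Type*} [Group G] [Group H] {i : G →* H} {m n : ℕ}

theorem WE.ComesFrom.exists_eq_of_home {x : H} (h : (WE.home x).ComesFrom i) :
    ∃ a, i a = x := by
  cases h with | home a => exact ⟨a, rfl⟩

theorem WE.ComesFrom.exists_mk_eq_of_conj {β : ConjClasses H} (h : (WE.conj β).ComesFrom i) :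
    ∃ a, ConjClasses.mk (i a) = β := by
  cases h with | conj a => exact ⟨a, rfl⟩

theorem WE.ComesFrom.exists_mk_eq_of_leftCoset {β : Quot (LeftCosetRel H m)}
    (h : (WE.leftCoset m β).ComesFrom i) : ∃ a b, Quot.mk _ (i a, i b) = β := by
  cases h with | leftCoset m a b => exact ⟨a, b, rfl⟩

theorem WE.ComesFrom.exists_mk_eq_of_rightCoset {β : Quot (RightCosetRel H m)}
    (h : (WE.rightCoset m β).ComesFrom i) : ∃ a b, Quot.mk _ (i a, i b) = β := by
  cases h with | rightCoset m a b => exact ⟨a, b, rfl⟩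

theorem WE.ComesFrom.exists_mk_eq_of_doubleCoset {β : Quot (DoubleCosetRel H m n)}
    (h : (WE.doubleCoset m n β).ComesFrom i) : ∃ a b c, Quot.mk _ (i a, i b, i c) = β := by
  cases h with | doubleCoset m n a b c => exact ⟨a, b, c, rfl⟩

end ComesFrom

namespace AdjoinFree

section FactorConj

variable {G : Type*} [Group G] {A B : Subgroup G}

/-- For `G = A * B`, the endomorphism of `G * ⟨e⟩` that is the identity on `A` and `⟨e⟩` and
conjugation by `d` on `B`. -/
noncomputable def factorConjHom
    (h : Function.Bijective (Monoid.Coprod.lift A.subtype B.subtype)) (d : AdjoinFree G) :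
    AdjoinFree G →* AdjoinFree G :=
  Monoid.Coprod.lift
    ((Monoid.Coprod.lift (ofBase.comp A.subtype)
      ((MulAut.conj d).toMonoidHom.comp (ofBase.comp B.subtype))).comp
        (MulEquiv.ofBijective _ h).symm.toMonoidHom)
    (zpowersHom _ e)

variable (h : Function.Bijective (Monoid.Coprod.lift A.subtype B.subtype))

theorem factorConjHom_left (d : AdjoinFree G) (a : A) :
    factorConjHom h d (ofBase (a : G)) = ofBase (a : G) := by
  have hsymm : (MulEquiv.ofBijective _ h).symm (a : G) = Monoid.Coprod.inl a := by
    simp [MulEquiv.symm_apply_eq]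
  simp [factorConjHom, ofBase, hsymm]

theorem factorConjHom_right (d : AdjoinFree G) (b : B) :
    factorConjHom h d (ofBase (b : G)) = d * ofBase (b : G) * d⁻¹ := by
  have hsymm : (MulEquiv.ofBijective _ h).symm (b : G) = Monoid.Coprod.inr b := by
    simp [MulEquiv.symm_apply_eq]
  simp [factorConjHom, ofBase, hsymm]

theorem factorConjHom_e (d : AdjoinFree G) : factorConjHom h d e = e := by
  simp [factorConjHom, e]

theorem factorConjHom_comp {d d' : AdjoinFree G} (hd : factorConjHom h d d' = d')
    (hdd' : d' * d = 1) : (factorConjHom h d).comp (factorConjHom h d') = MonoidHom.id _ := by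
  refine Monoid.Coprod.hom_ext (MonoidHom.ext fun g => ?_) (MonoidHom.ext_mint ?_)
  · change factorConjHom h d (factorConjHom h d' (ofBase g)) = ofBase g
    have hright (b : B) :
        factorConjHom h d (factorConjHom h d' (ofBase (b : G))) = ofBase (b : G) := by
      rw [factorConjHom_right, map_mul, map_mul, map_inv, hd, factorConjHom_right,
        eq_inv_of_mul_eq_one_left hdd']
      group
    obtain ⟨l, rfl⟩ := exists_alternatingProd_eq h.surjective g
    induction l with
    | nil => simp only [alternatingProd_nil, map_one]
    | cons p l ih => simp only [alternatingProd_cons, map_mul, factorConjHom_left, hright, ih]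
  · change factorConjHom h d (factorConjHom h d' e) = e
    rw [factorConjHom_e, factorConjHom_e]

/-- For `G = A * B`, the automorphism of `G * ⟨e⟩` that is the identity on `A` and `⟨e⟩` and
conjugation by `e` on `B`. -/
noncomputable def factorConj : MulAut (AdjoinFree G) :=
  MonoidHom.toMulEquiv (factorConjHom h e) (factorConjHom h e⁻¹)
    (factorConjHom_comp h (factorConjHom_e h _) (mul_inv_cancel e))
    (factorConjHom_comp h (by rw [map_inv, factorConjHom_e]) (inv_mul_cancel e))

theorem factorConj_left (a : A) : factorConj h (ofBase (a : G)) = ofBase (a : G) :=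
  factorConjHom_left h e a

theorem factorConj_right (b : B) :
    factorConj h (ofBase (b : G)) = e * ofBase (b : G) * e⁻¹ :=
  factorConjHom_right h e b

theorem factorConj_alternatingProd (l : List (B × A)) :
    factorConj h (ofBase (alternatingProd l)) =
      wordProd (l.flatMap fun p => [(1, (p.1 : G)), (-1, (p.2 : G))]) := by
  induction l with
  | nil => simp
  | cons p l ih => simp [ih, factorConj_left, factorConj_right, mul_assoc]

theorem isCyclicallyReduced_flatMap {l : List (B × A)} (hl : ∀ p ∈ l, p.1 ≠ 1 ∧ p.2 ≠ 1) :
    IsCyclicallyReduced (l.flatMap fun p => [((1 : ℤˣ), (p.1 : G)), (-1, (p.2 : G))]) := by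
  refine Cycle.chain_of_pairwise fun x hx y _ hx1 => absurd hx1 ?_
  obtain ⟨p, hp, hx⟩ := List.mem_flatMap.1 (Cycle.mem_coe_iff.1 hx)
  obtain ⟨hb, ha⟩ := hl p hp
  obtain rfl | rfl : x = (1, (p.1 : G)) ∨ x = (-1, (p.2 : G)) := by simpa using hx
  · simpa using hb
  · simpa using ha

theorem not_isConj_factorConj_alternatingProd {l : List (B × A)} (hne : l ≠ [])
    (hl : ∀ p ∈ l, p.1 ≠ 1 ∧ p.2 ≠ 1) (g : G) :
    ¬ IsConj (factorConj h (ofBase (alternatingProd l))) (ofBase g) := by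
  rw [factorConj_alternatingProd]
  obtain ⟨p, l, rfl⟩ := List.exists_cons_of_ne_nil hne
  exact (isCyclicallyReduced_flatMap hl).not_isConj_ofBase (List.cons_ne_nil _ _) g

theorem not_comesFrom_factorConj_smul_conj {g : G}
    (hg : ∀ x : G, x ∈ A ∨ x ∈ B → ¬ IsConj g x) :
    ¬ (factorConj h • WE.conj (ConjClasses.mk (ofBase g))).ComesFrom ofBase := by
  intro hfrom
  obtain ⟨g', hg'⟩ := hfrom.exists_mk_eq_of_conj
  have hconj : IsConj (ofBase g') (factorConj h (ofBase g)) := ConjClasses.mk_eq_mk_iff_isConj.1 hg'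
  obtain ⟨l, rfl⟩ := exists_alternatingProd_eq h.surjective g
  rcases exists_isConj_of_alternatingProd l with ⟨x, hx, hlx⟩ | ⟨l', hne, hl', hll'⟩
  · exact hg x hx hlx
  · have hmap := ((factorConj h : AdjoinFree G →* AdjoinFree G).comp ofBase).map_isConj hll'
    exact not_isConj_factorConj_alternatingProd h hne hl' g' (hconj.trans hmap).symm

theorem e_mul_ofBase_mul_inv_notMem_range_ofBase {g : G} (hg : g ≠ 1) :
    e * ofBase g * e⁻¹ ∉ (ofBase : G →* AdjoinFree G).range := fun ⟨_, h⟩ =>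
  e_notMem_range_ofBase (mem_range_ofBase_of_mul_eq_mul hg (mul_inv_eq_iff_eq_mul.1 h.symm))

include h in
theorem not_commute_of_mem_factors {a c : G} (haA : a ∈ A) (hcB : c ∈ B) (ha : a ≠ 1)
    (hc : c ≠ 1) : ¬ Commute a c := fun hac => by
  have hcomm : Commute (ofBase a) (e * ofBase c * e⁻¹) := by
    have hmap := (hac.map ofBase).map (factorConj h)
    rwa [factorConj_left h ⟨a, haA⟩, factorConj_right h ⟨c, hcB⟩] at hmap
  exact e_mul_ofBase_mul_inv_notMem_range_ofBase hc (mem_range_ofBase_of_commute ha hcomm)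

end FactorConj

section ConjE

variable {G : Type*} [Group G] {m n : ℕ}

theorem elemCentralizer_e_mul_ofBase_mul_inv_ne {g : G} (hg : g ≠ 1) (g' : G) :
    elemCentralizer (e * ofBase g * e⁻¹) ≠ elemCentralizer (ofBase g') := by
  intro h
  have hcomm {k : G} (hk : Commute k g') : Commute (ofBase k) (e * ofBase g * e⁻¹) := by
    have hmem : ofBase k ∈ elemCentralizer (ofBase g') :=
      Subgroup.mem_centralizer_singleton_iff.2 (hk.map ofBase)
    rw [← h] at hmem
    exact Subgroup.mem_centralizer_singleton_iff.1 hmem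
  obtain ⟨k, hk, hkg'⟩ : ∃ k ≠ 1, Commute k g' := by
    by_cases hg' : g' = 1
    · exact ⟨g, hg, hg' ▸ .one_right g⟩
    · exact ⟨g', hg', .refl g'⟩
  exact e_mul_ofBase_mul_inv_notMem_range_ofBase hg (mem_range_ofBase_of_commute hk (hcomm hkg'))

theorem e_mul_ofBase_mul_inv_ne_one {g : G} (hg : g ≠ 1) :
    e * ofBase g * e⁻¹ ≠ (1 : AdjoinFree G) := fun h =>
  e_mul_ofBase_mul_inv_notMem_range_ofBase hg (h ▸ one_mem _)

theorem doubleCoset_e_mul_ofBase_mul_inv_ne {p r p' : G} {q q' r' : AdjoinFree G} (hp : p ≠ 1)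
    (hr : r ≠ 1) : Quot.mk (DoubleCosetRel _ m n) (ofBase p', q', r') ≠
      Quot.mk _ (e * ofBase p * e⁻¹, q, e * ofBase r * e⁻¹) := fun h =>
  have hsame := (exists_mul_mul_eq_of_doubleCoset_eq (e_mul_ofBase_mul_inv_ne_one hp)
    (e_mul_ofBase_mul_inv_ne_one hr) h.symm).1
  elemCentralizer_e_mul_ofBase_mul_inv_ne hp p' hsame.elemCentralizer_eq

theorem not_comesFrom_conj_e_smul_home {g : G} (hg : g ≠ 1) :
    ¬ (MulAut.conj (e : AdjoinFree G) • WE.home (ofBase g)).ComesFrom ofBase := fun h =>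
  e_mul_ofBase_mul_inv_notMem_range_ofBase hg h.exists_eq_of_home

theorem not_comesFrom_conj_e_smul_leftCoset (a : G) {b : G} (hb : b ≠ 1) :
    ¬ (MulAut.conj (e : AdjoinFree G) •
      WE.leftCoset m (Quot.mk _ (ofBase a, ofBase b))).ComesFrom ofBase := fun h =>
  have ⟨_, _, heq⟩ := h.exists_mk_eq_of_leftCoset
  doubleCoset_e_mul_ofBase_mul_inv_ne hb hb (doubleCoset_eq_of_leftCoset_eq heq)

theorem not_comesFrom_conj_e_smul_rightCoset (a : G) {b : G} (hb : b ≠ 1) :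
    ¬ (MulAut.conj (e : AdjoinFree G) •
      WE.rightCoset m (Quot.mk _ (ofBase a, ofBase b))).ComesFrom ofBase := fun h =>
  have ⟨_, _, heq⟩ := h.exists_mk_eq_of_rightCoset
  doubleCoset_e_mul_ofBase_mul_inv_ne hb hb (doubleCoset_eq_of_rightCoset_eq heq)

theorem not_comesFrom_conj_e_smul_doubleCoset {a c : G} (b : G) (ha : a ≠ 1) (hc : c ≠ 1) :
    ¬ (MulAut.conj (e : AdjoinFree G) •
      WE.doubleCoset m n (Quot.mk _ (ofBase a, ofBase b, ofBase c))).ComesFrom ofBase := fun h =>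
  have ⟨_, _, _, heq⟩ := h.exists_mk_eq_of_doubleCoset
  doubleCoset_e_mul_ofBase_mul_inv_ne ha hc heq

end ConjE

section FreeProduct

variable {G : Type*} [Group G] {A B : Subgroup G} {β : WE (AdjoinFree G)}

theorem exists_not_comesFrom_smul
    (h : Function.Bijective (Monoid.Coprod.lift A.subtype B.subtype)) (hβ : ¬ β.IsTrivial)
    (hAB : ∀ x : G, x ∈ A ∨ x ∈ B → β ≠ WE.conj (ConjClasses.mk (ofBase x))) :
    ∃ f : MulAut (AdjoinFree G), ¬ (f • β).ComesFrom ofBase := by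
  by_cases hG : β.ComesFrom ofBase
  swap
  · exact ⟨1, by rwa [one_smul]⟩
  cases hG with
  | home g =>
    refine ⟨_, not_comesFrom_conj_e_smul_home fun hg => hβ ?_⟩
    rw [hg, map_one]
    exact .home
  | conj g =>
    exact ⟨_, not_comesFrom_factorConj_smul_conj h fun x hx hgx => hAB x hx
      (congrArg WE.conj (ConjClasses.mk_eq_mk_iff_isConj.2 (ofBase.map_isConj hgx)))⟩
  | leftCoset m a b =>
    refine ⟨_, not_comesFrom_conj_e_smul_leftCoset a fun hb => hβ ?_⟩
    have htriv : Quot.mk (LeftCosetRel (AdjoinFree G) m) (ofBase a, ofBase b) = Quot.mk _ (1, 1) :=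
      Quot.sound (.inl ⟨by simp [hb], rfl⟩)
    exact htriv ▸ .leftCoset m
  | rightCoset m a b =>
    refine ⟨_, not_comesFrom_conj_e_smul_rightCoset a fun hb => hβ ?_⟩
    have htriv : Quot.mk (RightCosetRel (AdjoinFree G) m) (ofBase a, ofBase b) = Quot.mk _ (1, 1) :=
      Quot.sound (.inl ⟨by simp [hb], rfl⟩)
    exact htriv ▸ .rightCoset m
  | doubleCoset m n a b c =>
    by_cases hac : a = 1 ∨ c = 1
    · have htriv : Quot.mk (DoubleCosetRel (AdjoinFree G) m n) (ofBase a, ofBase b, ofBase c) =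
          Quot.mk _ (1, 1, 1) :=
        Quot.sound (.inl ⟨hac.imp (by simp +contextual) (by simp +contextual), .inl rfl⟩)
      exact absurd (htriv ▸ .doubleCoset m n) hβ
    · obtain ⟨ha, hc⟩ := not_or.1 hac
      exact ⟨_, not_comesFrom_conj_e_smul_doubleCoset b ha hc⟩

theorem infinite_orbit_of_isNontrivialFreeProduct (htf : IsTorsionFreeGroup G)
    (hct : IsCommutativeTransitive G) (hAB : IsNontrivialFreeProduct A B)
    (hβ : ¬ β.ComesFrom ofBase) : (MulAction.orbit (MulAut (AdjoinFree G)) β).Infinite := by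
  obtain ⟨hA, hB, h⟩ := hAB
  obtain ⟨a, haA, ha⟩ := A.bot_or_exists_ne_one.resolve_left hA
  obtain ⟨c, hcB, hc⟩ := B.bot_or_exists_ne_one.resolve_left hB
  have hac := not_commute_of_mem_factors h haA hcB ha hc
  refine (infinite_orbit_closure_shift htf hct hac hβ).mono ?_
  rintro _ ⟨f, rfl⟩
  exact MulAction.mem_orbit β (f : MulAut (AdjoinFree G))

end FreeProduct

end AdjoinFree

theorem mainTheorem8_general {G : Type*} [Group G] (htf : IsTorsionFreeGroup G)
    (hct : IsCommutativeTransitive G) :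
    (∀ a c : G, a ≠ 1 → c ≠ 1 → elemCentralizer a ≠ elemCentralizer c →
      ∀ β : WE (AdjoinFree G), ¬ β.ComesFrom AdjoinFree.ofBase →
        (MulAction.orbit (Subgroup.closure {AdjoinFree.shift a, AdjoinFree.shift c}) β).Infinite) ∧
    (∀ A B : Subgroup G, IsNontrivialFreeProduct A B →
      (∀ β : WE (AdjoinFree G), ¬ β.ComesFrom AdjoinFree.ofBase →
        (MulAction.orbit (MulAut (AdjoinFree G)) β).Infinite) ∧
      (∀ β : WE (AdjoinFree G), ¬ β.IsTrivial →
        (∀ x : G, x ∈ A ∨ x ∈ B → β ≠ WE.conj (ConjClasses.mk (AdjoinFree.ofBase x))) →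
        (MulAction.orbit (MulAut (AdjoinFree G)) β).Infinite)) := by
  refine ⟨fun a c ha hc hac β => AdjoinFree.infinite_orbit_closure_shift htf hct
    (hct.not_commute_of_elemCentralizer_ne ha hc hac), fun A B hAB => ?_⟩
  have infinite_of_not_comesFrom {β : WE (AdjoinFree G)} (hβ : ¬ β.ComesFrom AdjoinFree.ofBase) :=
    AdjoinFree.infinite_orbit_of_isNontrivialFreeProduct htf hct hAB hβ
  refine ⟨fun β => infinite_of_not_comesFrom, fun β hβ hx => ?_⟩
  obtain ⟨f, hf⟩ := AdjoinFree.exists_not_comesFrom_smul hAB.2.2 hβ hx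
  rw [← MulAction.orbit_smul f β]
  exact infinite_of_not_comesFrom hf

theorem mainTheorem8 {G : Type*} [Group G] (hG : IsHyperbolicGroup G)
    (htf : IsTorsionFreeGroup G) :
    (∀ a c : G, a ≠ 1 → c ≠ 1 → elemCentralizer a ≠ elemCentralizer c →
      ∀ β : WE (AdjoinFree G), ¬ β.ComesFrom AdjoinFree.ofBase →
        (MulAction.orbit (Subgroup.closure {AdjoinFree.shift a, AdjoinFree.shift c}) β).Infinite) ∧
    (∀ A B : Subgroup G, IsNontrivialFreeProduct A B →
      (∀ β : WE (AdjoinFree G), ¬ β.ComesFrom AdjoinFree.ofBase →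
        (MulAction.orbit (MulAut (AdjoinFree G)) β).Infinite) ∧
      (∀ β : WE (AdjoinFree G), ¬ β.IsTrivial →
        (∀ x : G, x ∈ A ∨ x ∈ B → β ≠ WE.conj (ConjClasses.mk (AdjoinFree.ofBase x))) →
        (MulAction.orbit (MulAut (AdjoinFree G)) β).Infinite)) :=
  mainTheorem8_general htf (hG.isCommutativeTransitive htf)
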